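/- Setting. Let $(\Omega,\mathcal F,\mathbb P)$ be a probability space, $\mathcal G\subset\mathcal F$ a sub-$\sigma$-algebra and $(J_{ij})_{1\le i<j<\infty}$ real random variables with $|J_{ij}|\le k_J$ $\mathbb P$-a.s. for a constant $k_J\in(0,\infty)$ (conditional independence of the $J_{ij}$ given $\mathcal G$ is not needed). Let $\beta>0$, $h\in\mathbb R$. For $N\ge2$ and $\sigma\in\mathcal S_N=\{-1,1\}^N$ let $$H_N(\sigma)=-\frac1N\sum_{1\le i<j\le N}J_{ij}\sigma_i\sigma_j-h\sum_{i=1}^N\sigma_i,\qquad \widetilde H_N(\sigma)=\mathbb E[H_N(\sigma)\mid\mathcal G]$$ be the quenched and the annealed Hamiltonian. For a Hamiltonian $H$ the Gibbs measure is $\mu(\sigma)=e^{-\beta H(\sigma)}/\sum_{\sigma'}e^{-\beta H(\sigma')}$, and the dynamics is the continuous-time Markov chain $\Sigma$ on $\mathcal S_N$ with rates $p(\sigma,\sigma')=\exp(-\beta[H(\sigma')-H(\sigma)]_+)$ if $\sigma'$ is obtained from $\sigma$ by flipping a single spin, and $0$ otherwise; $L$ is its generator, $P_\sigma$ its law started at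 $\sigma$, $P_\nu$ its law with initial distribution $\nu$, and $\tau_{\mathcal X}=\inf\{t>0:\Sigma(t)\in\mathcal X,\ \Sigma(t-)\notin\mathcal X\}$. Write $\mu_N,L_N$ for the objects of $H_N$, and $\tilde\mu_N,\widetilde P$ for those of $\widetilde H_N$; $\mu|\mathcal X$ is $\mu$ conditioned on $\mathcal X$. For disjoint $\mathcal A,\mathcal B$, not both empty, $h^N_{\mathcal A,\mathcal B}$ is the unique function with $L_Nf=0$ off $\mathcal A\cup\mathcal B$, $f=1$ on $\mathcal A$, $f=0$ on $\mathcal B$, and $\|f\|_{\mu_N}=\sum_\sigma\mu_N(\sigma)|f(\sigma)|$. Metastability. Let $K\ge2$. The chain is $\rho$-metastable with respect to non-empty, pairwise disjoint sets $\mathcal M_1,\dots,\mathcal M_K\subset\mathcal S_N$ with union $\mathcal M\ne\mathcal S_N$ if $$K\,\frac{\max_{j}P_{\mu|\mathcal M_j}[\tau_{\mathcal M\setminus\mathcal M_j}<\tau_{\mathcal M_j}]}{\min_{\emptyset\ne\mathcal X\subset\mathcal S_N\setminus\mathcal M}P_{\mu|\mathcal X}[\tau_{\mathcal M}<\tau_{\mathcal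 X}]}\le\rho .$$ Fix $k_1>0$. Let $\widetilde\Omega_{\rm meta}(N)$ be the event that the annealed chain is $e^{-k_1N}$-metastable with respect to some $K$ such sets. For each $N\ge 2$, on this event ($\mathbb P$-a.s.), fix such sets $\mathcal M_{1,N},\dots,\mathcal M_{K,N}$ and a metastable partition, i.e. a partition $\mathcal S_{1,N},\dots,\mathcal S_{K,N}$ of $\mathcal S_N$ with $\mathcal M_{j,N}\subset\mathcal S_{j,N}\subset\mathcal V_{j,N}$, where, with $\mathcal M_N=\bigcup_j\mathcal M_{j,N}$, $$\mathcal V_{j,N}=\mathcal M_{j,N}\cup\Bigl\{\sigma\notin\mathcal M_N:\widetilde P_\sigma[\tau_{\mathcal M_{j,N}}<\tau_{\mathcal M_N\setminus\mathcal M_{j,N}}]\ge\max_{l\ne j}\widetilde P_\sigma[\tau_{\mathcal M_{l,N}}<\tau_{\mathcal M_N\setminus\mathcal M_{l,N}}]\Bigr\}.$$ Non-degeneracy. Let $i\in\{2,\dots,K\}$ and $k_2>0$ be such that, for all $N\ge2$, $\mathbb P$-a.s. on $\widetilde\Omega_{\rm meta}(N)$, $\tilde\mu_N[\mathcal M_{1,N}]\ge\dots\ge\tilde\mu_N[\mathcal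 M_{K,N}]$ and $\tilde\mu_N[\mathcal S_{j,N}]\le e^{-k_2N}\tilde\mu_N[\mathcal S_{i,N}]$ for all $j\in\{i+1,\dots,K\}$. Put $\mathcal A_N=\mathcal M_{i,N}$ and $\mathcal B_N=\bigcup_{j=1}^{i-1}\mathcal M_{j,N}$. Proposition. Let $(a_N)_{N\in\mathbb N}$ be a non-negative real sequence with $a_N/N\to0$, and let $\Xi(a_N)=\{\max_{\sigma\in\mathcal S_N}|H_N(\sigma)-\widetilde H_N(\sigma)|<a_N\}$. Then there are $C\in(0,k_1\wedge k_2)$ and $N_0\ge 2$, depending only on $(a_N)_N,\beta,k_1,k_2$, and a finite constant $c$, depending in addition only on $h,k_J,K$, such that for every $N\ge N_0$, $\mathbb P$-a.s. on the event $\Xi(a_N)\cap\widetilde\Omega_{\rm meta}(N)$, $$\Bigl|\,\|h^N_{\mathcal A_N,\mathcal B_N}\|_{\mu_N}-\mu_N[\mathcal S_{i,N}]\,\Bigr|\le c\,e^{-CN}\,\mu_N[\mathcal S_{i,N}],$$ that is, $\|h^N_{\mathcal A_N,\mathcal B_N}\|_{\mu_N}=\mu_N[\mathcal S_{i,N}]\,(1+O(e^{-CN}))$.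 -/

import Mathlib

open MeasureTheory ProbabilityTheory Filter Topology
open scoped NNReal ENNReal

namespace GlauberMeta

/-! ### Continuous-time Markov chains on a finite state space

A chain with transition rates `c x y` (for `x ≠ y`) is built from its jump chain and an independent
sequence of unit exponential clocks. -/

section Chain

variable {V : Type*} [Fintype V] [DecidableEq V]

/-- The total jump rate out of `x`. -/
noncomputable def totalRate (c : V → V → ℝ≥0) (x : V) : ℝ≥0 := ∑ y, c x y

/-- The law of the next state of the jump chain: `y` has probability `c x y / totalRate c x`
(an absorbing state stays put). -/
noncomputable def jumpPMF (c : V → V → ℝ≥0) (x : V) : PMF V :=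
  PMF.ofFintype
    (fun y => (if totalRate c x = 0 then (if y = x then 1 else 0)
      else c x y / totalRate c x : ℝ≥0))
    (by
      rw [← ENNReal.ofNNReal_finsetSum, ENNReal.coe_eq_one]
      by_cases hx : totalRate c x = 0
      · simp [hx]
      · simp only [hx, if_false]
        rw [← Finset.sum_div]
        exact div_self hx)

/-- The time of the `n`-th jump along the jump-chain trajectory `y`, when the unit clocks show `e`:
the `k`-th holding time is `e k / totalRate c (y k)`, an exponential variable of rate
`totalRate c (y k)`. -/
noncomputable def jumpTime (c : V → V → ℝ≥0) (y : ℕ → V) (e : ℕ → ℝ) (n : ℕ) : ℝ≥0∞ :=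
  ∑ k ∈ Finset.range n, ENNReal.ofReal (e k) / (totalRate c (y k) : ℝ≥0∞)

/-- The state at time `t`: the jump chain after as many steps as there are jumps up to time `t`. -/
noncomputable def stateAt (c : V → V → ℝ≥0) (ω : (ℕ → V) × (ℕ → ℝ)) (t : ℝ≥0) : V :=
  ω.1 (Set.ncard {n : ℕ | jumpTime c ω.1 ω.2 (n + 1) ≤ (t : ℝ≥0∞)})

/-- The first return time of a path `X` to `A`, i.e. `inf {t > 0 : X t ∈ A, X (t-) ∉ A}`
(infinite if there is no such `t`). -/
noncomputable def returnTime (X : ℝ≥0 → V) (A : Finset V) : ℝ≥0∞ :=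
  ⨅ (t : ℝ≥0) (_ : 0 < t ∧ X t ∈ A ∧ ∃ x, x ∉ A ∧ ∀ᶠ s in 𝓝[<] t, X s = x), (t : ℝ≥0∞)

variable [MeasurableSpace V] [MeasurableSingletonClass V]

/-- The transition kernel of the jump chain. -/
noncomputable def jumpKernel (c : V → V → ℝ≥0) : Kernel V V :=
  Kernel.ofFunOfCountable (fun x => (jumpPMF c x).toMeasure)

instance (c : V → V → ℝ≥0) : IsMarkovKernel (jumpKernel c) :=
  ⟨fun x => inferInstanceAs (IsProbabilityMeasure (jumpPMF c x).toMeasure)⟩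

instance : IsProbabilityMeasure (expMeasure 1) := isProbabilityMeasure_expMeasure one_pos

/-- The jump-chain kernel, reading only the last state of the history. -/
noncomputable def historyKernel (c : V → V → ℝ≥0) (n : ℕ) :
    Kernel ((_ : Finset.Iic n) → V) V :=
  (jumpKernel c).comap (fun y => y ⟨n, Finset.mem_Iic.2 le_rfl⟩) (measurable_pi_apply _)

instance (c : V → V → ℝ≥0) (n : ℕ) : IsMarkovKernel (historyKernel c n) := by
  unfold historyKernel; infer_instance

/-- The joint law of the jump chain started in `x` and of the independent unit exponential clocks;
under it, `stateAt c` is the Markov chain with rates `c` started in `x`. -/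
noncomputable def chainLaw (c : V → V → ℝ≥0) (x : V) : Measure ((ℕ → V) × (ℕ → ℝ)) :=
  (Kernel.traj (X := fun _ : ℕ => V) (historyKernel c) 0 (fun _ => x)).prod
    (Measure.infinitePi (fun _ : ℕ => expMeasure 1))

/-- `hitBefore c B A x` is the probability that `τ_B < τ_A` for the chain started in `x`. -/
noncomputable def hitBefore (c : V → V → ℝ≥0) (B A : Finset V) (x : V) : ℝ :=
  (chainLaw c x).real {ω | returnTime (stateAt c ω) B < returnTime (stateAt c ω) A}

end Chain

/-! ### The Ising model with Glauber–Metropolis dynamics -/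

/-- Spin configurations `{-1, 1}^N`. -/
abbrev Config (N : ℕ) : Type := Fin N → ℤˣ

instance : MeasurableSingletonClass ℤˣ :=
  ⟨fun u => ⟨{(u : ℤ)}, MeasurableSet.singleton _, by
    ext v; simp [Units.ext_iff]⟩⟩

/-- The Hamiltonian with couplings `J i j`, `i < j`, and magnetic field `h`. -/
noncomputable def hamiltonian (N : ℕ) (h : ℝ) (J : ℕ → ℕ → ℝ) (σ : Config N) : ℝ :=
  -(1 / (N : ℝ)) * ∑ p : Fin N × Fin N with p.1 < p.2,
      J p.1 p.2 * ((σ p.1 : ℤ) : ℝ) * ((σ p.2 : ℤ) : ℝ)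
    - h * ∑ i, ((σ i : ℤ) : ℝ)

/-- `σ'` is obtained from `σ` by the flip of a single spin. -/
def IsFlip {N : ℕ} (σ σ' : Config N) : Prop := ∃ k, σ' = Function.update σ k (-σ k)

section Gibbs

variable {N : ℕ} (β : ℝ) (H : Config N → ℝ)

/-- The Gibbs weight of a configuration. -/
noncomputable def gibbs (σ : Config N) : ℝ :=
  Real.exp (-β * H σ) / ∑ σ', Real.exp (-β * H σ')

/-- The Gibbs measure of a set of configurations. -/
noncomputable def gibbsMass (X : Finset (Config N)) : ℝ := ∑ σ ∈ X, gibbs β H σ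

open Classical in
/-- The Metropolis transition rates. -/
noncomputable def rate (σ σ' : Config N) : ℝ≥0 :=
  if IsFlip σ σ' then (Real.exp (-β * max (H σ' - H σ) 0)).toNNReal else 0

/-- The generator of the dynamics. -/
noncomputable def generator (f : Config N → ℝ) (σ : Config N) : ℝ :=
  ∑ σ', (rate β H σ σ' : ℝ) * (f σ' - f σ)

/-- The probability of `τ_B < τ_A` when the initial law is the Gibbs measure conditioned on `X`. -/
noncomputable def hitBeforeFrom (X B A : Finset (Config N)) : ℝ :=
  ∑ σ ∈ X, gibbs β H σ / gibbsMass β H X * hitBefore (rate β H) B A σ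

/-- The union of a family of sets of configurations. -/
def unionAll {K : ℕ} (M : Fin K → Finset (Config N)) : Finset (Config N) := Finset.univ.biUnion M

/-- The dynamics with Hamiltonian `H` is `ρ`-metastable with respect to the nonempty, pairwise
disjoint sets `M j`. These must not cover the whole space, since otherwise the minimum in the
denominator runs over no set at all. -/
def IsMetastable (ρ : ℝ) {K : ℕ} (M : Fin K → Finset (Config N)) : Prop :=
  (∀ j, (M j).Nonempty) ∧ (∀ j k, j ≠ k → Disjoint (M j) (M k)) ∧
  unionAll M ≠ Finset.univ ∧
  (K : ℝ) * (⨆ j, hitBeforeFrom β H (M j) (unionAll M \ M j) (M j)) /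
    (⨅ X : {X : Finset (Config N) // X.Nonempty ∧ Disjoint X (unionAll M)},
      hitBeforeFrom β H X (unionAll M) X) ≤ ρ

/-- `σ` lies in the local valley around `M i`. -/
def InValley {K : ℕ} (M : Fin K → Finset (Config N)) (i : Fin K) (σ : Config N) : Prop :=
  σ ∈ M i ∨ (σ ∉ unionAll M ∧ ∀ j, j ≠ i →
    hitBefore (rate β H) (M j) (unionAll M \ M j) σ
      ≤ hitBefore (rate β H) (M i) (unionAll M \ M i) σ)

/-- `S` is a metastable partition of the configuration space for the metastable sets `M`. -/
def IsMetastablePartition {K : ℕ} (M S : Fin K → Finset (Config N)) : Prop :=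
  (∀ j k, j ≠ k → Disjoint (S j) (S k)) ∧ unionAll S = Finset.univ ∧
  ∀ j, M j ⊆ S j ∧ ∀ σ ∈ S j, InValley β H M j σ

/-- The boundary value problem of the equilibrium potential of the pair `(A, B)`. -/
def SolvesDirichlet (A B : Finset (Config N)) (f : Config N → ℝ) : Prop :=
  (∀ σ, σ ∉ A ∪ B → generator β H f σ = 0) ∧ (∀ σ ∈ A, f σ = 1) ∧ (∀ σ ∈ B, f σ = 0)

end Gibbs

/-! #### The boundary value problem is well posed -/

section WellPosed

variable {N : ℕ} (β : ℝ) (H : Config N → ℝ)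

lemma rate_pos {σ σ' : Config N} (h : IsFlip σ σ') : 0 < (rate β H σ σ' : ℝ) := by
  rw [rate, if_pos h, NNReal.coe_pos, Real.toNNReal_pos]
  exact Real.exp_pos _

lemma flip_connected (σ σ' : Config N) : Relation.ReflTransGen IsFlip σ σ' := by
  have key : ∀ s : Finset (Fin N), Relation.ReflTransGen IsFlip σ (s.piecewise σ' σ) := by
    intro s
    induction s using Finset.induction_on with
    | empty => simpa using Relation.ReflTransGen.refl
    | insert k s hk ih =>
      rw [Finset.piecewise_insert]
      by_cases hkk : σ' k = σ k
      · have h1 : s.piecewise σ' σ k = σ' k := by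
          rw [Finset.piecewise_eq_of_notMem _ _ _ hk, hkk]
        rw [← h1, Function.update_eq_self]
        exact ih
      · refine ih.tail ⟨k, ?_⟩
        rw [Finset.piecewise_eq_of_notMem _ _ _ hk, ← Int.units_ne_iff_eq_neg.1 hkk]
  simpa using key Finset.univ

/-- Maximum principle. -/
lemma le_zero_of_harmonic {D : Finset (Config N)} (hD : D.Nonempty) {f : Config N → ℝ}
    (h0 : ∀ σ ∈ D, f σ = 0) (hL : ∀ σ, σ ∉ D → generator β H f σ = 0) (σ : Config N) :
    f σ ≤ 0 := by
  obtain ⟨m, -, hm⟩ := Finset.exists_max_image Finset.univ f ⟨σ, Finset.mem_univ σ⟩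
  by_contra! hpos
  have hmpos : 0 < f m := hpos.trans_le (hm σ (Finset.mem_univ σ))
  obtain ⟨b, hb⟩ := hD
  have hall : ∀ τ, Relation.ReflTransGen IsFlip m τ → f τ = f m := by
    intro τ hτ
    induction hτ with
    | refl => rfl
    | @tail x y _ hxy ih =>
      have hx : x ∉ D := fun hx => by
        have := h0 x hx
        linarith
      have hterm : ∀ z ∈ Finset.univ, (rate β H x z : ℝ) * (f z - f x) ≤ 0 := fun z hz =>
        mul_nonpos_of_nonneg_of_nonpos (NNReal.coe_nonneg _) (by have := hm z hz; linarith)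
      have hz := (Finset.sum_eq_zero_iff_of_nonpos hterm).1 (hL x hx) y (Finset.mem_univ y)
      rcases mul_eq_zero.1 hz with h | h
      · exact absurd h (rate_pos β H hxy).ne'
      · linarith
  have := hall b (flip_connected m b)
  rw [h0 b hb] at this
  linarith

theorem existsUnique_solvesDirichlet {A B : Finset (Config N)} (hAB : Disjoint A B)
    (hne : (A ∪ B).Nonempty) : ∃! f, SolvesDirichlet β H A B f := by
  let T : (Config N → ℝ) →ₗ[ℝ] (Config N → ℝ) :=
    { toFun := fun f σ => if σ ∈ A ∪ B then f σ else generator β H f σ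
      map_add' := fun f g => by
        ext σ
        by_cases hσ : σ ∈ A ∪ B
        · simp only [hσ, if_true, Pi.add_apply]
        · simp only [hσ, if_false, Pi.add_apply, generator, ← Finset.sum_add_distrib]
          exact Finset.sum_congr rfl fun _ _ => by ring
      map_smul' := fun r f => by
        ext σ
        by_cases hσ : σ ∈ A ∪ B
        · simp only [hσ, if_true, Pi.smul_apply, RingHom.id_apply]
        · simp only [hσ, if_false, Pi.smul_apply, RingHom.id_apply, generator, smul_eq_mul,
            Finset.mul_sum]
          exact Finset.sum_congr rfl fun _ _ => by ring }
  have hT : ∀ f σ, T f σ = if σ ∈ A ∪ B then f σ else generator β H f σ := fun _ _ => rfl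
  have hle : ∀ f, T f = 0 → ∀ σ, f σ ≤ 0 := fun f hf =>
    le_zero_of_harmonic β H hne
      (fun σ hσ => by have := congrFun hf σ; rwa [hT, if_pos hσ] at this)
      (fun σ hσ => by have := congrFun hf σ; rwa [hT, if_neg hσ] at this)
  have hinj : Function.Injective T := by
    rw [← LinearMap.ker_eq_bot, LinearMap.ker_eq_bot']
    intro f hf
    ext σ
    have h1 := hle f hf σ
    have h2 := hle (-f) (by rw [map_neg, hf, neg_zero]) σ
    simp only [Pi.neg_apply] at h2
    simp only [Pi.zero_apply]
    linarith
  have hiff : ∀ f, SolvesDirichlet β H A B f ↔ T f = fun σ => if σ ∈ A then 1 else 0 := by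
    intro f
    constructor
    · rintro ⟨hL, hA, hB⟩
      ext σ
      rw [hT]
      by_cases hσA : σ ∈ A
      · simp [hσA, hA σ hσA]
      · by_cases hσB : σ ∈ B
        · simp [hσA, hσB, hB σ hσB]
        · rw [if_neg (by simp [hσA, hσB]), if_neg hσA, hL σ (by simp [hσA, hσB])]
    · intro hf
      have hv := fun σ => congrFun hf σ
      simp only [hT] at hv
      refine ⟨fun σ hσ => ?_, fun σ hσ => ?_, fun σ hσ => ?_⟩
      · have := hv σ
        rwa [if_neg hσ, if_neg (fun h => hσ (Finset.mem_union_left _ h))] at this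
      · have := hv σ
        rwa [if_pos (Finset.mem_union_left _ hσ), if_pos hσ] at this
      · have := hv σ
        rwa [if_pos (Finset.mem_union_right _ hσ),
          if_neg (Finset.disjoint_right.1 hAB hσ)] at this
  obtain ⟨f, hf⟩ := (LinearMap.injective_iff_surjective.1 hinj) (fun σ => if σ ∈ A then 1 else 0)
  exact ⟨f, (hiff f).2 hf, fun g hg => hinj (((hiff g).1 hg).trans hf.symm)⟩

open Classical in
/-- The equilibrium potential of the pair `(A, B)`: the unique solution of the boundary value
problem, for `A`, `B` disjoint and not both empty. -/
noncomputable def equilibriumPotential (A B : Finset (Config N)) : Config N → ℝ :=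
  if h : ∃ f, SolvesDirichlet β H A B f then h.choose else 0

theorem equilibriumPotential_spec {A B : Finset (Config N)} (hAB : Disjoint A B)
    (hne : (A ∪ B).Nonempty) : SolvesDirichlet β H A B (equilibriumPotential β H A B) := by
  have h := (existsUnique_solvesDirichlet β H hAB hne).exists
  rw [equilibriumPotential, dif_pos h]
  exact h.choose_spec

/-- The norm of `f` in `ℓ¹` of the Gibbs measure. -/
noncomputable def gibbsNorm (f : Config N → ℝ) : ℝ := ∑ σ, gibbs β H σ * |f σ|

end WellPosed

/-! ### The quenched and the annealed model -/

section Disorder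

variable {Ω : Type*} (G : MeasurableSpace Ω) [mΩ : MeasurableSpace Ω] (P : Measure Ω)
  (J : ℕ → ℕ → Ω → ℝ) (h : ℝ) (N : ℕ)

/-- The quenched Hamiltonian. -/
noncomputable def quenchedH (ω : Ω) (σ : Config N) : ℝ :=
  hamiltonian N h (fun i j => J i j ω) σ

/-- The annealed Hamiltonian: the conditional mean given `G` of the quenched one. -/
noncomputable def annealedH (ω : Ω) (σ : Config N) : ℝ :=
  (P[fun ω' => quenchedH J h N ω' σ | G]) ω

/-- The event that the two Hamiltonians differ by less than `a`, uniformly in the configuration. -/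
def closeEvent (a : ℝ) : Set Ω :=
  {ω | ∀ σ : Config N, |quenchedH J h N ω σ - annealedH G P J h N ω σ| < a}

/-- The event that the annealed model is `exp (-k₁ N)`-metastable with respect to some `K` sets. -/
def annealedMetaEvent (β k₁ : ℝ) (K : ℕ) : Set Ω :=
  {ω | ∃ M : Fin K → Finset (Config N),
    IsMetastable β (annealedH G P J h N ω) (Real.exp (-k₁ * N)) M}

end Disorder

end GlauberMeta

open GlauberMeta

/-!
The proof has a probabilistic part, which turns the return probabilities in the definitions into
potential theory, and a part that only deals with capacities.

*Return probabilities.* Along almost every path all clocks are positive and there is no explosion,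
so `τ_B < τ_A` is an event of the jump chain (`returnTime_lt_iff`), and the Markov property at the
first jump gives a linear relation for its probability (`totalRate_mul_hitBefore`). Off `A ∪ B` this
probability is therefore the equilibrium potential (`hitBefore_eq_equilibriumPotential`). Started in
`A`, however, it may be larger than what the first jump alone gives, since moves inside `A` do not count
as returns. One still has `cap (A, B) ≤ N μ(A) P_{μ|A}[τ_B < τ_A]`, with a converse up to a constant
if no flip leads from `A` to `A`. As the hypercube is bipartite, every set contains such a subset
with at least half of its mass, and metastability becomes
`cap (M_j, M \ M_j) μ(X) ≤ const · ρ · μ(M_j) cap (X, M)` for all `X` disjoint from `M`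
(`IsMetastable.capacity_mul_le`).

*Valleys.* On the valley of `M_j` the probability to reach `M_j` first is at least `1 / K`, so
reversibility gives `cap (X, M) ≤ K cap (X, M_j)` for `X` in this valley
(`IsMetastablePartition.capacity_le`). All of this concerns the annealed chain, but capacities and
masses of two Hamiltonians at distance `a` differ at most by a factor `exp (2 β a)`, so the
resulting bound `μ(X) cap (A, B) ≤ Q cap (X, M_j)`, with `A = M_i`, holds for the quenched chain.

*Level sets.* A superlevel set `X = {h ≥ t}` of the potential `h` of `(A, B)` has `cap (X, B) ≤ cap
(A, B) / t` (`capacity_superlevel_le`), whence `μ(X) ≤ Q / t` for `X` inside the valley of some `M_j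
⊆ B`. Summing over dyadic levels `t = 2 ^ (-n)` down to a level that is exponentially small compared
with the mass of any configuration takes `O(N)` levels, and shows that the valleys with `j < i`
contribute little to the norm of `h`. The same bound for `1 - h`, the potential of `(B, A)`, on the
valley of `M_i` shows that this valley contributes almost its full mass. The valleys with `j > i`
are negligible by non-degeneracy.
-/

namespace GlauberMeta

/-! ### Return times along a single path -/

section Path

variable {V : Type*}

/-- The jump chain `y` enters `B` from outside at some step, and does not enter `A` from outside
up to that step. -/
def EntersBefore (B A : Finset V) (y : ℕ → V) : Prop :=
  ∃ n, (y (n + 1) ∈ B ∧ y n ∉ B) ∧ ∀ m ≤ n, ¬(y (m + 1) ∈ A ∧ y m ∉ A)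

/-- The first step decides the event or leaves it to the shifted sequence. -/
lemma entersBefore_iff_of_notMem {A B : Finset V} (hAB : Disjoint A B) {z : ℕ → V}
    (h0 : z 0 ∉ B) :
    EntersBefore B A z ↔ z 1 ∈ B ∨ (¬(z 1 ∈ A ∧ z 0 ∉ A) ∧
      EntersBefore B A fun n => z (n + 1)) := by
  constructor
  · rintro ⟨n, hn, hm⟩
    obtain _ | n := n
    · exact Or.inl hn.1
    · exact Or.inr ⟨hm 0 (by omega), n, hn, fun m hmn => hm (m + 1) (by omega)⟩
  · rintro (h | ⟨h, n, hn, hm⟩)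
    · refine ⟨0, ⟨h, h0⟩, fun m hm => ?_⟩
      obtain rfl : m = 0 := by omega
      exact fun h' => Finset.disjoint_left.1 hAB h'.1 h
    · refine ⟨n + 1, hn, fun m hmn => ?_⟩
      obtain _ | m := m
      · exact h
      · exact hm m (by omega)

variable [Fintype V] {c : V → V → ℝ≥0} {y : ℕ → V} {e : ℕ → ℝ}

lemma jumpTime_ne_top (hr : ∀ k, totalRate c (y k) ≠ 0) (n : ℕ) : jumpTime c y e n ≠ ⊤ := by
  refine ENNReal.sum_ne_top.2 fun k _ => ENNReal.div_ne_top ENNReal.ofReal_ne_top ?_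
  exact_mod_cast hr k

lemma jumpTime_strictMono (hr : ∀ k, totalRate c (y k) ≠ 0) (he : ∀ k, 0 < e k) :
    StrictMono (jumpTime c y e) := by
  refine strictMono_nat_of_lt_succ fun n => ?_
  have h : jumpTime c y e (n + 1)
      = jumpTime c y e n + ENNReal.ofReal (e n) / (totalRate c (y n) : ℝ≥0∞) :=
    Finset.sum_range_succ _ _
  rw [h]
  refine ENNReal.lt_add_right (jumpTime_ne_top hr n) ?_
  exact (ENNReal.div_pos (ENNReal.ofReal_pos.2 (he n)).ne' ENNReal.coe_ne_top).ne'

lemma stateAt_eq (hr : ∀ k, totalRate c (y k) ≠ 0) (he : ∀ k, 0 < e k) {t : ℝ≥0} {n : ℕ}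
    (h1 : jumpTime c y e n ≤ t) (h2 : t < jumpTime c y e (n + 1)) :
    stateAt c (y, e) t = y n := by
  have hT := jumpTime_strictMono hr he
  have : {m : ℕ | jumpTime c y e (m + 1) ≤ (t : ℝ≥0∞)} = (Finset.range n : Set ℕ) := by
    ext m
    simp only [Set.mem_ofPred_eq, Finset.coe_range, Set.mem_Iio]
    constructor
    · intro hm
      have := hT.lt_iff_lt.1 (hm.trans_lt h2)
      omega
    · intro hm
      exact (hT.monotone (by omega : m + 1 ≤ n)).trans h1
  change y (Set.ncard {m : ℕ | jumpTime c y e (m + 1) ≤ (t : ℝ≥0∞)}) = y n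
  rw [this, Set.ncard_coe_finset, Finset.card_range]

lemma exists_jumpTime_le_lt (ht : ∀ R : ℝ≥0, ∃ n, (R : ℝ≥0∞) < jumpTime c y e n) (t : ℝ≥0) :
    ∃ n, jumpTime c y e n ≤ t ∧ t < jumpTime c y e (n + 1) := by
  classical
  have h := ht t
  have h0 : Nat.find h ≠ 0 := by
    intro h0
    have := Nat.find_spec h
    rw [h0] at this
    simp [jumpTime] at this
  obtain ⟨k, hk⟩ := Nat.exists_eq_succ_of_ne_zero h0
  refine ⟨k, not_lt.1 (Nat.find_min h (by omega)), ?_⟩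
  have := Nat.find_spec h
  rwa [hk] at this

/-- A path enters `A` exactly at those jump times at which the jump chain enters `A`. -/
lemma enters_iff (hr : ∀ k, totalRate c (y k) ≠ 0) (he : ∀ k, 0 < e k)
    (ht : ∀ R : ℝ≥0, ∃ n, (R : ℝ≥0∞) < jumpTime c y e n) (A : Finset V) (t : ℝ≥0) :
    (0 < t ∧ stateAt c (y, e) t ∈ A ∧ ∃ x, x ∉ A ∧ ∀ᶠ s in 𝓝[<] t, stateAt c (y, e) s = x) ↔
      ∃ n, (t : ℝ≥0∞) = jumpTime c y e (n + 1) ∧ y (n + 1) ∈ A ∧ y n ∉ A := by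
  have hT := jumpTime_strictMono hr he
  have left : ∀ n : ℕ, jumpTime c y e n < t → t ≤ jumpTime c y e (n + 1) →
      ∀ᶠ s in 𝓝[<] t, stateAt c (y, e) s = y n := by
    intro n h1 h2
    have hlt : (jumpTime c y e n).toNNReal < t := by
      rwa [← ENNReal.coe_lt_coe, ENNReal.coe_toNNReal (jumpTime_ne_top hr n)]
    filter_upwards [Ioo_mem_nhdsLT hlt] with s hs
    refine stateAt_eq hr he ?_ ?_
    · rw [← ENNReal.coe_toNNReal (jumpTime_ne_top hr n)]
      exact_mod_cast hs.1.le
    · exact lt_of_lt_of_le (by exact_mod_cast hs.2) h2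
  constructor
  · rintro ⟨h0, hA, x, hx, hev⟩
    have : (𝓝[<] t).NeBot := nhdsLT_neBot_of_exists_lt ⟨0, h0⟩
    obtain ⟨n, h1, h2⟩ := exists_jumpTime_le_lt ht t
    rw [stateAt_eq hr he h1 h2] at hA
    rcases h1.lt_or_eq with h1 | h1
    · obtain ⟨s, hs, hs'⟩ := (hev.and (left n h1 h2.le)).exists
      exact absurd (hs.symm.trans hs' ▸ hA) hx
    · obtain _ | n := n
      · rw [jumpTime, Finset.sum_range_zero, eq_comm, ENNReal.coe_eq_zero] at h1
        exact absurd h1 h0.ne'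
      · obtain ⟨s, hs, hs'⟩ :=
          (hev.and (left n (h1 ▸ hT (Nat.lt_succ_self n)) h1.ge)).exists
        exact ⟨n, h1.symm, hA, hs.symm.trans hs' ▸ hx⟩
  · rintro ⟨n, h, hA, hn⟩
    have hlt : jumpTime c y e n < t := h ▸ hT (Nat.lt_succ_self n)
    refine ⟨by exact_mod_cast (zero_le.trans_lt hlt : (0 : ℝ≥0∞) < t), ?_, y n, hn,
      left n hlt h.le⟩
    rwa [stateAt_eq hr he h.ge (h ▸ hT (Nat.lt_succ_self _))]

lemma returnTime_lt_iff (hr : ∀ k, totalRate c (y k) ≠ 0) (he : ∀ k, 0 < e k)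
    (ht : ∀ R : ℝ≥0, ∃ n, (R : ℝ≥0∞) < jumpTime c y e n) (A B : Finset V) :
    returnTime (stateAt c (y, e)) B < returnTime (stateAt c (y, e)) A ↔ EntersBefore B A y := by
  have hT := jumpTime_strictMono hr he
  have hle : ∀ (A : Finset V) n, y (n + 1) ∈ A → y n ∉ A →
      returnTime (stateAt c (y, e)) A ≤ jumpTime c y e (n + 1) := by
    intro A n h1 h2
    have h := ENNReal.coe_toNNReal (jumpTime_ne_top (e := e) hr (n + 1))
    rw [← h]
    exact iInf₂_le (f := fun (t : ℝ≥0) _ => (t : ℝ≥0∞)) _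
      ((enters_iff hr he ht A _).2 ⟨n, h, h1, h2⟩)
  constructor
  · intro h
    obtain ⟨t, h⟩ := iInf_lt_iff.1 h
    obtain ⟨hB, h⟩ := iInf_lt_iff.1 h
    obtain ⟨n, htn, h1, h2⟩ := (enters_iff hr he ht B t).1 hB
    refine ⟨n, ⟨h1, h2⟩, fun m hm hA => ?_⟩
    have := (hle A m hA.1 hA.2).trans (hT.monotone (by omega : m + 1 ≤ n + 1))
    rw [htn] at h
    exact absurd h this.not_gt
  · rintro ⟨n, ⟨h1, h2⟩, hA⟩
    refine (hle B n h1 h2).trans_lt ((hT (Nat.lt_succ_self (n + 1))).trans_le ?_)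
    refine le_iInf₂ fun t h => ?_
    obtain ⟨m, htm, h3, h4⟩ := (enters_iff hr he ht A t).1 h
    rw [htm]
    refine hT.monotone ?_
    by_contra hlt
    exact hA m (by simp only [Nat.succ_eq_add_one] at hlt; omega) ⟨h3, h4⟩

end Path

/-! ### First-step analysis of return times -/

/-- Almost surely, all exponential clocks are positive and infinitely many of them exceed `1`; the
latter excludes explosion of a chain with bounded rates. -/
lemma ae_clocks : ∀ᵐ e ∂Measure.infinitePi (fun _ : ℕ => expMeasure 1),
    (∀ k, 0 < e k) ∧ ∃ᶠ k in atTop, 1 < e k := by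
  have hp : ∀ᵐ r ∂expMeasure 1, 0 < r := by
    have h := cdf_expMeasure_eq one_pos 0
    rw [cdf_eq_real] at h
    simp only [le_refl, if_true, mul_zero, neg_zero, Real.exp_zero, sub_self] at h
    have h' : expMeasure 1 (Set.Iic 0) = 0 := (measureReal_eq_zero_iff (by finiteness)).1 h
    rw [ae_iff]
    convert h' using 2
    ext r; simp
  have h1 : ∀ k : ℕ, ∀ᵐ e ∂Measure.infinitePi (fun _ : ℕ => expMeasure 1), 0 < e k := fun k =>
    (measurePreserving_eval_infinitePi (μ := fun _ : ℕ => expMeasure 1)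
      k).quasiMeasurePreserving.ae hp
  have hm : ∀ k : ℕ, MeasurableSet {e : ℕ → ℝ | 1 < e k} := fun k =>
    measurableSet_lt measurable_const (measurable_pi_apply k)
  have hval : ∀ k : ℕ, Measure.infinitePi (fun _ : ℕ => expMeasure 1) {e : ℕ → ℝ | 1 < e k}
      = expMeasure 1 (Set.Ioi 1) := fun k =>
    (measurePreserving_eval_infinitePi (μ := fun _ : ℕ => expMeasure 1) k).measure_preimage
      measurableSet_Ioi.nullMeasurableSet
  have hpos : expMeasure 1 (Set.Ioi 1) ≠ 0 := by
    intro h0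
    have h := cdf_expMeasure_eq one_pos 1
    rw [cdf_eq_real, if_pos zero_le_one] at h
    have h1 : (expMeasure 1).real (Set.Iic 1) = 1 := by
      have hc : Set.Iic (1 : ℝ) = (Set.Ioi 1)ᶜ := by ext; simp
      rw [hc, probReal_compl_eq_one_sub measurableSet_Ioi, Measure.real, h0]; simp
    have := Real.exp_pos (-(1 * 1))
    linarith
  have hind : iIndepSet (fun k : ℕ => {e : ℕ → ℝ | 1 < e k})
      (Measure.infinitePi (fun _ : ℕ => expMeasure 1)) := by
    rw [iIndepSet_iff_meas_biInter hm]
    intro s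
    have hs : (⋂ i ∈ s, {e : ℕ → ℝ | 1 < e i}) = Set.pi (s : Set ℕ) fun _ => Set.Ioi 1 := by
      ext e; simp [Set.mem_pi]
    rw [hs, Measure.infinitePi_pi (fun _ : ℕ => expMeasure 1) (fun _ _ => measurableSet_Ioi)]
    exact Finset.prod_congr rfl fun i _ => (hval i).symm
  have hlim := measure_limsup_eq_one hm hind (by
    simp only [hval]
    exact ENNReal.tsum_const_eq_top_of_ne_zero hpos)
  have h2 : ∀ᵐ e ∂Measure.infinitePi (fun _ : ℕ => expMeasure 1),
      e ∈ limsup (fun k : ℕ => {e : ℕ → ℝ | 1 < e k}) atTop :=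
    (mem_ae_iff_prob_eq_one (MeasurableSet.measurableSet_limsup hm)).2 hlim
  filter_upwards [ae_all_iff.2 h1, h2] with e he he'
  exact ⟨he, mem_limsup_iff_frequently_mem.1 he'⟩

section Law

variable {V : Type*}

/-- The sequence with first entry `x`, continued by `z`. -/
def consSeq (x : V) (z : ℕ → V) : ℕ → V
  | 0 => x
  | n + 1 => z n

lemma measurable_consSeq [MeasurableSpace V] (x : V) : Measurable (consSeq x) := by
  refine measurable_pi_iff.2 fun n => ?_
  cases n with
  | zero => exact measurable_const
  | succ n => exact measurable_pi_apply n

lemma measurableSet_entersBefore [MeasurableSpace V] [MeasurableSingletonClass V] (B A : Finset V) :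
    MeasurableSet {y : ℕ → V | EntersBefore B A y} := by
  have h : ∀ (A : Finset V) n, MeasurableSet {y : ℕ → V | y n ∈ A} := fun A n =>
    (measurable_pi_apply n) A.measurableSet
  have h' : ∀ (A : Finset V) n, MeasurableSet {y : ℕ → V | y (n + 1) ∈ A ∧ y n ∉ A} :=
    fun A n => (h A (n + 1)).inter (h A n).compl
  have : {y : ℕ → V | EntersBefore B A y} = ⋃ n, ({y | y (n + 1) ∈ B ∧ y n ∉ B} ∩
      ⋂ m, ⋂ (_ : m ≤ n), {y | y (m + 1) ∈ A ∧ y m ∉ A}ᶜ) := by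
    ext y
    simp [EntersBefore]
  rw [this]
  exact MeasurableSet.iUnion fun n => (h' B n).inter
    (MeasurableSet.iInter fun m => MeasurableSet.iInter fun _ => (h' A m).compl)

lemma measurableSet_cylinder [MeasurableSpace V] [MeasurableSingletonClass V] (v : ℕ → V) (n : ℕ) :
    MeasurableSet {y : ℕ → V | ∀ k ≤ n, y k = v k} := by
  have : {y : ℕ → V | ∀ k ≤ n, y k = v k} = ⋂ k, ⋂ (_ : k ≤ n), {y | y k = v k} := by
    ext; simp
  rw [this]
  exact MeasurableSet.iInter fun k => MeasurableSet.iInter fun _ =>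
    (measurable_pi_apply k) (measurableSet_singleton _)

variable [Fintype V]

/-- The chain does not explode if infinitely many clocks exceed `1`. -/
lemma exists_lt_jumpTime {c : V → V → ℝ≥0} {y : ℕ → V} {e : ℕ → ℝ}
    (he : ∃ᶠ k in atTop, 1 < e k) (R : ℝ≥0) : ∃ n, (R : ℝ≥0∞) < jumpTime c y e n := by
  have htop : ∑' k, ENNReal.ofReal (e k) / (totalRate c (y k) : ℝ≥0∞) = ⊤ := by
    by_contra hne
    have h0 := ENNReal.tendsto_atTop_zero_of_tsum_ne_top hne
    -- the total rates are bounded by their sum over the finite state space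
    set b : ℝ≥0 := ∑ x, totalRate c x
    have hb : (0 : ℝ≥0∞) < 1 / (b : ℝ≥0∞) := ENNReal.div_pos one_ne_zero ENNReal.coe_ne_top
    obtain ⟨k, hk, hk'⟩ := (he.and_eventually (h0.eventually_lt_const hb)).exists
    refine absurd hk' (not_lt.2 (ENNReal.div_le_div ?_ ?_))
    · rw [← ENNReal.ofReal_one]
      exact ENNReal.ofReal_le_ofReal hk.le
    · exact_mod_cast Finset.single_le_sum (f := fun x => totalRate c x) (fun _ _ => zero_le)
        (Finset.mem_univ (y k))
  rw [ENNReal.tsum_eq_iSup_nat] at htop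
  exact lt_iSup_iff.1 (htop ▸ ENNReal.coe_lt_top)

variable [DecidableEq V] [MeasurableSpace V] [MeasurableSingletonClass V]
  (c : V → V → ℝ≥0)

/-- The law of the jump chain started in `x`. -/
noncomputable def jumpLaw (x : V) : Measure (ℕ → V) :=
  Kernel.traj (X := fun _ : ℕ => V) (historyKernel c) 0 (fun _ => x)

instance (x : V) : IsProbabilityMeasure (jumpLaw c x) := by
  unfold jumpLaw; infer_instance

lemma hitBefore_eq_jumpLaw (hc : ∀ x, totalRate c x ≠ 0) (B A : Finset V) (x : V) :
    hitBefore c B A x = (jumpLaw c x).real {y | EntersBefore B A y} := by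
  have hae : {ω | returnTime (stateAt c ω) B < returnTime (stateAt c ω) A}
      =ᵐ[chainLaw c x] {y | EntersBefore B A y} ×ˢ Set.univ := by
    rw [Filter.eventuallyEq_set]
    have h : ∀ᵐ ω ∂chainLaw c x, (∀ k, 0 < ω.2 k) ∧ ∃ᶠ k in atTop, 1 < ω.2 k :=
      Measure.quasiMeasurePreserving_snd.ae ae_clocks
    filter_upwards [h] with ω hω
    rw [Set.mem_prod]
    simp only [Set.mem_univ, and_true]
    exact returnTime_lt_iff (fun k => hc _) hω.1 (exists_lt_jumpTime hω.2) A B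
  rw [hitBefore, measureReal_congr hae, chainLaw, measureReal_prod_prod]
  simp [jumpLaw]

/-- The finite-dimensional distributions of the jump chain. -/
lemma jumpLaw_cylinder (x : V) (v : ℕ → V) (n : ℕ) :
    jumpLaw c x {y | ∀ k ≤ n, y k = v k}
      = (if v 0 = x then 1 else 0) * ∏ k ∈ Finset.range n, jumpPMF c (v k) (v (k + 1)) := by
  have hcyl : ∀ n, {y : ℕ → V | ∀ k ≤ n, y k = v k}
      = Preorder.frestrictLe (π := fun _ : ℕ => V) n ⁻¹' {fun k : Finset.Iic n => v k} := by
    intro n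
    ext y
    simp only [Set.mem_ofPred_eq, Set.mem_preimage, Set.mem_singleton_iff, funext_iff]
    exact ⟨fun h k => h k (Finset.mem_Iic.1 k.2), fun h k hk => h ⟨k, Finset.mem_Iic.2 hk⟩⟩
  induction n with
  | zero =>
    rw [hcyl, jumpLaw, ← Measure.map_apply (by fun_prop) (measurableSet_singleton _),
      Kernel.traj_map_frestrictLe_apply, Kernel.partialTraj_self, Kernel.id_apply,
      Measure.dirac_apply' _ (measurableSet_singleton _)]
    simp only [Finset.range_zero, Finset.prod_empty, mul_one, Set.indicator, Pi.one_apply]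
    congr 1
    simp only [Set.mem_singleton_iff, funext_iff, eq_iff_iff]
    exact ⟨fun h => (h ⟨0, by simp⟩).symm, fun h k => by
      have : (k : ℕ) = 0 := Nat.le_zero.1 (Finset.mem_Iic.1 k.2)
      rw [this, h]⟩
  | succ n ih =>
    have hset : {y : ℕ → V | ∀ k ≤ n + 1, y k = v k}
        = (fun y : ℕ → V => (Preorder.frestrictLe (π := fun _ : ℕ => V) n y, y (n + 1))) ⁻¹'
          ({fun k : Finset.Iic n => v k} ×ˢ {v (n + 1)}) := by
      ext y
      have h1 := congrArg (fun s => y ∈ s) (hcyl n)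
      simp only [Set.mem_ofPred_eq, Set.mem_preimage, Set.mem_singleton_iff, eq_iff_iff] at h1
      simp only [Set.mem_ofPred_eq, Set.mem_preimage, Set.mem_prod, Set.mem_singleton_iff, ← h1]
      exact ⟨fun h => ⟨fun k hk => h k (by omega), h _ le_rfl⟩, fun h k hk => by
        rcases Nat.le_succ_iff.1 hk with hk | rfl
        exacts [h.1 k hk, h.2]⟩
    rw [hset, jumpLaw, ← Measure.map_apply (by fun_prop)
      ((measurableSet_singleton _).prod (measurableSet_singleton _)),
      ← Kernel.partialTraj_compProd_eq_map_traj (Nat.zero_le n),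
      Measure.compProd_apply_prod (measurableSet_singleton _) (measurableSet_singleton _),
      lintegral_singleton, ← Kernel.traj_map_frestrictLe_apply,
      Measure.map_apply (by fun_prop) (measurableSet_singleton _), ← hcyl]
    change (jumpPMF c (v n)).toMeasure {v (n + 1)} * jumpLaw c x {y | ∀ k ≤ n, y k = v k} = _
    rw [ih, PMF.toMeasure_apply_singleton _ _ (measurableSet_singleton _),
      Finset.prod_range_succ]
    ring

lemma jumpLaw_ae_zero (x : V) : ∀ᵐ y ∂jumpLaw c x, y 0 = x := by
  have h := jumpLaw_cylinder c x (fun _ => x) 0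
  rw [if_pos rfl, Finset.range_zero, Finset.prod_empty, mul_one] at h
  have h0 : Measurable fun y : ℕ → V => y 0 := measurable_pi_apply 0
  have hm : MeasurableSet {y : ℕ → V | y 0 = x} := h0 (measurableSet_singleton x)
  refine (mem_ae_iff_prob_eq_one hm).2 (h ▸ congrArg _ ?_)
  ext y; simp

lemma jumpLaw_cylinder_eq_sum (x : V) (v : ℕ → V) (n : ℕ) :
    jumpLaw c x {y | ∀ k ≤ n, y k = v k}
      = (∑ y, jumpPMF c x y • (jumpLaw c y).map (consSeq x)) {y | ∀ k ≤ n, y k = v k} := by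
  rw [Measure.finsetSum_apply]
  simp only [Measure.smul_apply, smul_eq_mul,
    Measure.map_apply (measurable_consSeq x) (measurableSet_cylinder v n)]
  rw [jumpLaw_cylinder]
  obtain _ | n := n
  · have : consSeq x ⁻¹' {y | ∀ k ≤ 0, y k = v k} = if v 0 = x then Set.univ else ∅ := by
      ext z
      split_ifs with h <;> simp [consSeq, h, eq_comm]
    rw [this]
    have hsum : ∑ y, jumpPMF c x y = 1 := by
      rw [← tsum_fintype (L := .unconditional V)]; exact (jumpPMF c x).tsum_coe
    split_ifs with h <;> simp [hsum]
  · by_cases h : v 0 = x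
    · have : consSeq x ⁻¹' {y | ∀ k ≤ n + 1, y k = v k}
          = {z | ∀ k ≤ n, z k = v (k + 1)} := by
        ext z
        simp only [Set.mem_preimage, Set.mem_ofPred_eq]
        exact ⟨fun hz k hk => hz (k + 1) (by omega), fun hz k hk => by
          cases k with
          | zero => exact h.symm
          | succ k => exact hz k (by omega)⟩
      rw [this, if_pos h, Finset.prod_range_succ', Finset.sum_eq_single (v 1)]
      · rw [jumpLaw_cylinder, if_pos rfl, h]
        ring
      · intro y _ hy
        rw [jumpLaw_cylinder c y (fun k => v (k + 1)), if_neg (Ne.symm hy)]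
        simp
      · simp
    · have : consSeq x ⁻¹' {y | ∀ k ≤ n + 1, y k = v k} = ∅ := by
        ext z
        simp only [Set.mem_preimage, Set.mem_ofPred_eq, Set.mem_empty_iff_false, iff_false]
        exact fun hz => h (hz 0 (by omega)).symm
      rw [this, if_neg h]
      simp

/-- The Markov property of the jump chain at its first step. -/
lemma jumpLaw_eq_sum (x : V) :
    jumpLaw c x = ∑ y, jumpPMF c x y • (jumpLaw c y).map (consSeq x) := by
  have hfin : ∀ I : Finset ℕ, IsFiniteMeasure (inducedFamily (X := fun _ : ℕ => V)
      (fun n => Kernel.partialTraj (X := fun _ : ℕ => V) (historyKernel c) 0 n fun _ => x) I) :=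
    fun I => by rw [inducedFamily]; infer_instance
  refine (Kernel.isProjectiveLimit_trajFun (X := fun _ : ℕ => V) (historyKernel c) 0
    (fun _ => x)).unique ?_
  have hproj := Kernel.isProjectiveMeasureFamily_partialTraj (X := fun _ : ℕ => V)
    (historyKernel c) (a := 0) (fun _ => x)
  rw [isProjectiveLimit_nat_iff hproj]
  intro n
  rw [inducedFamily_Iic, ← Kernel.traj_map_frestrictLe_apply]
  refine Measure.ext_of_singleton fun w => ?_
  rw [Measure.map_apply (by fun_prop) (measurableSet_singleton _),
    Measure.map_apply (by fun_prop) (measurableSet_singleton _)]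
  have hpre : Preorder.frestrictLe (π := fun _ : ℕ => V) n ⁻¹' {w}
      = {y | ∀ k ≤ n, y k = (fun k => if h : k ≤ n then w ⟨k, Finset.mem_Iic.2 h⟩ else x) k} := by
    ext y
    simp only [Set.mem_ofPred_eq, Set.mem_preimage, Set.mem_singleton_iff, funext_iff]
    exact ⟨fun h k hk => by rw [dif_pos hk]; exact h ⟨k, Finset.mem_Iic.2 hk⟩, fun h k => by
      have := h k (Finset.mem_Iic.1 k.2)
      rwa [dif_pos (Finset.mem_Iic.1 k.2)] at this⟩
  rw [hpre]
  exact (jumpLaw_cylinder_eq_sum c x _ n).symm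

open Classical in
/-- The conditional probability of `τ_B < τ_A` after a first jump from `x ∉ B` to `y`. A jump inside
`A` is not a return to `A`, so that the chain then continues from `y`. -/
noncomputable def afterStep (B A : Finset V) (x y : V) : ℝ :=
  if y ∈ B then 1 else if y ∈ A ∧ x ∉ A then 0 else hitBefore c B A y

/-- First-step analysis: conditioning on the first jump, from a state outside `B`. -/
lemma totalRate_mul_hitBefore (hc : ∀ x, totalRate c x ≠ 0) {B A : Finset V}
    (hAB : Disjoint A B) {x : V} (hx : x ∉ B) :
    (totalRate c x : ℝ) * hitBefore c B A x = ∑ y, (c x y : ℝ) * afterStep c B A x y := by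
  have hy : ∀ y, (jumpLaw c y).real (consSeq x ⁻¹' {z | EntersBefore B A z})
      = afterStep c B A x y := by
    intro y
    have hiff : ∀ᵐ z ∂jumpLaw c y, (z ∈ consSeq x ⁻¹' {z | EntersBefore B A z} ↔
        y ∈ B ∨ (¬(y ∈ A ∧ x ∉ A) ∧ EntersBefore B A z)) := by
      filter_upwards [jumpLaw_ae_zero c y] with z hz
      have := entersBefore_iff_of_notMem hAB (z := consSeq x z) hx
      simp only [consSeq, hz] at this
      exact this
    rw [afterStep]
    split_ifs with h1 h2
    · rw [measureReal_congr (t := Set.univ), probReal_univ]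
      rw [Filter.eventuallyEq_set]
      filter_upwards [hiff] with z hz
      exact hz.trans (by simp [h1])
    · rw [measureReal_congr (t := ∅), measureReal_empty]
      rw [Filter.eventuallyEq_set]
      filter_upwards [hiff] with z hz
      exact hz.trans (by simp [h1, h2])
    · rw [hitBefore_eq_jumpLaw c hc]
      refine measureReal_congr ?_
      rw [Filter.eventuallyEq_set]
      filter_upwards [hiff] with z hz
      exact hz.trans (by simp [h1, h2])
  have hE := measurableSet_entersBefore B A
  rw [hitBefore_eq_jumpLaw c hc, jumpLaw_eq_sum, Measure.real, Measure.finsetSum_apply,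
    ENNReal.toReal_sum (fun y _ => by
      rw [Measure.smul_apply, smul_eq_mul]
      exact ENNReal.mul_ne_top (PMF.apply_ne_top _ _) (by finiteness)), Finset.mul_sum]
  refine Finset.sum_congr rfl fun y _ => ?_
  rw [Measure.smul_apply, smul_eq_mul, ENNReal.toReal_mul,
    Measure.map_apply (measurable_consSeq x) hE, ← hy y, Measure.real, ← mul_assoc]
  congr 1
  have : jumpPMF c x y = ((c x y / totalRate c x : ℝ≥0) : ℝ≥0∞) := by
    simp [jumpPMF, PMF.ofFintype_apply, hc x]
  rw [this, ENNReal.coe_toReal, NNReal.coe_div]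
  exact mul_div_cancel₀ _ (by exact_mod_cast hc x)

end Law

/-! ### Potential theory of the Glauber dynamics -/

section Potential

variable {N : ℕ} (β : ℝ) (H : Config N → ℝ)

lemma sum_exp_pos : 0 < ∑ σ : Config N, Real.exp (-β * H σ) :=
  Finset.sum_pos (fun _ _ => Real.exp_pos _) Finset.univ_nonempty

lemma gibbs_pos (σ : Config N) : 0 < gibbs β H σ :=
  div_pos (Real.exp_pos _) (sum_exp_pos β H)

lemma sum_gibbs : ∑ σ, gibbs β H σ = 1 := by
  simp only [gibbs]
  rw [← Finset.sum_div]
  exact div_self (sum_exp_pos β H).ne'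

lemma gibbsMass_pos {X : Finset (Config N)} (hX : X.Nonempty) : 0 < gibbsMass β H X :=
  Finset.sum_pos (fun σ _ => gibbs_pos β H σ) hX

lemma gibbsMass_mono {X Y : Finset (Config N)} (h : X ⊆ Y) : gibbsMass β H X ≤ gibbsMass β H Y :=
  Finset.sum_le_sum_of_subset_of_nonneg h fun σ _ _ => (gibbs_pos β H σ).le

lemma gibbsMass_le_one (X : Finset (Config N)) : gibbsMass β H X ≤ 1 :=
  (gibbsMass_mono β H (Finset.subset_univ X)).trans (sum_gibbs β H).le

/-- The conductance of the edge between `σ` and `τ`: the equilibrium flow `μ σ * p (σ, τ)`. -/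
noncomputable def conductance (σ τ : Config N) : ℝ := gibbs β H σ * rate β H σ τ

lemma IsFlip.symm {σ τ : Config N} (h : IsFlip σ τ) : IsFlip τ σ := by
  obtain ⟨k, rfl⟩ := h
  exact ⟨k, by simp⟩

open Classical in
lemma conductance_eq (σ τ : Config N) : conductance β H σ τ =
    if IsFlip σ τ then Real.exp (-β * max (H σ) (H τ)) / ∑ σ', Real.exp (-β * H σ') else 0 := by
  rw [conductance, rate]
  split_ifs with h
  · have hm : max (H σ) (H τ) = H σ + max (H τ - H σ) 0 := by
      rw [max_comm, ← max_add_add_left, add_sub_cancel, add_zero]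
    rw [Real.coe_toNNReal _ (Real.exp_pos _).le, gibbs, div_mul_eq_mul_div, ← Real.exp_add, hm,
      mul_add]
  · simp

lemma conductance_comm (σ τ : Config N) : conductance β H σ τ = conductance β H τ σ := by
  classical
  rw [conductance_eq, conductance_eq, max_comm]
  congr 1
  exact propext ⟨IsFlip.symm, IsFlip.symm⟩

lemma conductance_nonneg (σ τ : Config N) : 0 ≤ conductance β H σ τ :=
  mul_nonneg (gibbs_pos β H σ).le (NNReal.coe_nonneg _)

/-- The Dirichlet form of the dynamics. -/
noncomputable def dirichletForm (f g : Config N → ℝ) : ℝ :=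
  1 / 2 * ∑ σ, ∑ τ, conductance β H σ τ * ((f σ - f τ) * (g σ - g τ))

/-- The measure `-μ L f`; for an equilibrium potential `f` it is carried by the boundary. -/
noncomputable def charge (f : Config N → ℝ) (σ : Config N) : ℝ :=
  -(gibbs β H σ * generator β H f σ)

lemma charge_eq_sum (f : Config N → ℝ) (σ : Config N) :
    charge β H f σ = ∑ τ, conductance β H σ τ * (f σ - f τ) := by
  rw [charge, generator, Finset.mul_sum, ← Finset.sum_neg_distrib]
  exact Finset.sum_congr rfl fun τ _ => by rw [conductance]; ring

/-- Summation by parts. -/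
lemma dirichletForm_eq_sum_charge (f g : Config N → ℝ) :
    dirichletForm β H f g = ∑ σ, charge β H f σ * g σ := by
  have h1 : ∑ σ, ∑ τ, conductance β H σ τ * ((f σ - f τ) * g τ)
      = -∑ σ, charge β H f σ * g σ := by
    rw [Finset.sum_comm, ← Finset.sum_neg_distrib]
    refine Finset.sum_congr rfl fun σ _ => ?_
    rw [charge_eq_sum, Finset.sum_mul, ← Finset.sum_neg_distrib]
    refine Finset.sum_congr rfl fun τ _ => ?_
    rw [conductance_comm β H τ σ]; ring
  have h2 : ∑ σ, ∑ τ, conductance β H σ τ * ((f σ - f τ) * g σ)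
      = ∑ σ, charge β H f σ * g σ := by
    refine Finset.sum_congr rfl fun σ _ => ?_
    rw [charge_eq_sum, Finset.sum_mul]
    exact Finset.sum_congr rfl fun τ _ => by ring
  have h3 : ∑ σ, ∑ τ, conductance β H σ τ * ((f σ - f τ) * (g σ - g τ))
      = ∑ σ, ∑ τ, conductance β H σ τ * ((f σ - f τ) * g σ)
        - ∑ σ, ∑ τ, conductance β H σ τ * ((f σ - f τ) * g τ) := by
    simp only [← Finset.sum_sub_distrib]
    exact Finset.sum_congr rfl fun σ _ => Finset.sum_congr rfl fun τ _ => by ring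
  rw [dirichletForm, h3, h1, h2]
  ring

lemma dirichletForm_comm (f g : Config N → ℝ) : dirichletForm β H f g = dirichletForm β H g f := by
  simp only [dirichletForm]
  congr 1
  exact Finset.sum_congr rfl fun σ _ => Finset.sum_congr rfl fun τ _ => by ring

lemma dirichletForm_mono {f g f' g' : Config N → ℝ}
    (h : ∀ σ τ, (f σ - f τ) * (g σ - g τ) ≤ (f' σ - f' τ) * (g' σ - g' τ)) :
    dirichletForm β H f g ≤ dirichletForm β H f' g' := by
  refine mul_le_mul_of_nonneg_left ?_ (by norm_num)
  exact Finset.sum_le_sum fun σ _ => Finset.sum_le_sum fun τ _ =>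
    mul_le_mul_of_nonneg_left (h σ τ) (conductance_nonneg β H σ τ)

lemma dirichletForm_self_nonneg (f : Config N → ℝ) : 0 ≤ dirichletForm β H f f :=
  mul_nonneg (by norm_num) (Finset.sum_nonneg fun σ _ => Finset.sum_nonneg fun τ _ =>
    mul_nonneg (conductance_nonneg β H σ τ) (mul_self_nonneg _))

lemma dirichletForm_smul_right (f g : Config N → ℝ) (r : ℝ) :
    dirichletForm β H f (fun σ => r * g σ) = r * dirichletForm β H f g := by
  rw [dirichletForm_eq_sum_charge, dirichletForm_eq_sum_charge, Finset.mul_sum]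
  exact Finset.sum_congr rfl fun σ _ => by ring

lemma dirichletForm_sub_right (f g g' : Config N → ℝ) :
    dirichletForm β H f (fun σ => g σ - g' σ) = dirichletForm β H f g - dirichletForm β H f g' := by
  simp only [dirichletForm_eq_sum_charge, ← Finset.sum_sub_distrib]
  exact Finset.sum_congr rfl fun σ _ => by ring

/-- Truncation does not increase the energy. -/
lemma min_sub_min_mul_le (a b t : ℝ) :
    (min a t - min b t) * (min a t - min b t) ≤ (a - b) * (min a t - min b t) := by
  rcases le_total a t with h1 | h1 <;> rcases le_total b t with h2 | h2 <;>
    simp only [min_eq_left, min_eq_right, h1, h2] <;> nlinarith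

/-- The capacity of the pair `(A, B)`: the energy of its equilibrium potential. -/
noncomputable def capacity (A B : Finset (Config N)) : ℝ :=
  dirichletForm β H (equilibriumPotential β H A B) (equilibriumPotential β H A B)

variable {β H} {A B : Finset (Config N)}

/-- By connectedness, only constants have no energy. -/
lemma eq_of_dirichletForm_nonpos {u : Config N → ℝ} (h0 : dirichletForm β H u u ≤ 0)
    (a b : Config N) : u a = u b := by
  have hterm : ∀ σ τ, 0 ≤ conductance β H σ τ * ((u σ - u τ) * (u σ - u τ)) := fun σ τ =>
    mul_nonneg (conductance_nonneg β H σ τ) (mul_self_nonneg _)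
  have h1 : ∑ σ, ∑ τ, conductance β H σ τ * ((u σ - u τ) * (u σ - u τ)) = 0 := by
    have := h0.antisymm (dirichletForm_self_nonneg β H u)
    rw [dirichletForm] at this; linarith
  have hflip : ∀ σ τ, IsFlip σ τ → u σ = u τ := by
    intro σ τ hστ
    have h2 := (Finset.sum_eq_zero_iff_of_nonneg fun σ _ => Finset.sum_nonneg
      fun τ _ => hterm σ τ).1 h1 σ (Finset.mem_univ _)
    have h3 := (Finset.sum_eq_zero_iff_of_nonneg fun τ _ => hterm σ τ).1 h2 τ (Finset.mem_univ _)
    have hc : conductance β H σ τ ≠ 0 := (mul_pos (gibbs_pos β H σ) (rate_pos β H hστ)).ne'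
    have := mul_self_eq_zero.1 ((mul_eq_zero.1 h3).resolve_left hc)
    linarith
  have : ∀ τ, Relation.ReflTransGen IsFlip a τ → u a = u τ := by
    intro τ hτ
    induction hτ with
    | refl => rfl
    | tail _ hxy ih => exact ih.trans (hflip _ _ hxy)
  exact this b (flip_connected a b)

lemma SolvesDirichlet.charge_eq_zero {f : Config N → ℝ} (hf : SolvesDirichlet β H A B f)
    {σ : Config N} (hσ : σ ∉ A ∪ B) : charge β H f σ = 0 := by
  rw [charge, hf.1 σ hσ, mul_zero, neg_zero]

/-- The energy pairing with a solution of the boundary value problem depends only on the boundary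
values of the other function. -/
lemma SolvesDirichlet.dirichletForm_congr {f g g' : Config N → ℝ}
    (hf : SolvesDirichlet β H A B f) (hg : ∀ σ ∈ A ∪ B, g σ = g' σ) :
    dirichletForm β H f g = dirichletForm β H f g' := by
  rw [dirichletForm_eq_sum_charge, dirichletForm_eq_sum_charge]
  refine Finset.sum_congr rfl fun σ _ => ?_
  by_cases hσ : σ ∈ A ∪ B
  · rw [hg σ hσ]
  · rw [hf.charge_eq_zero hσ, zero_mul, zero_mul]

variable (hAB : Disjoint A B) (hA : A.Nonempty)
include hAB hA

lemma equilibriumPotential_solves :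
    SolvesDirichlet β H A B (equilibriumPotential β H A B) :=
  equilibriumPotential_spec β H hAB (hA.mono Finset.subset_union_left)

lemma eq_equilibriumPotential {f : Config N → ℝ} (hf : SolvesDirichlet β H A B f) :
    f = equilibriumPotential β H A B :=
  (existsUnique_solvesDirichlet β H hAB (hA.mono Finset.subset_union_left)).unique hf
    (equilibriumPotential_solves hAB hA)

/-- The Dirichlet principle. -/
lemma capacity_le_dirichletForm {f : Config N → ℝ} (h1 : ∀ σ ∈ A, f σ = 1)
    (h0 : ∀ σ ∈ B, f σ = 0) : capacity β H A B ≤ dirichletForm β H f f := by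
  have hs := equilibriumPotential_solves (β := β) (H := H) hAB hA
  set u := equilibriumPotential β H A B with hu
  have h2 : dirichletForm β H u f = capacity β H A B := hs.dirichletForm_congr fun σ hσ => by
    rw [← hu]
    rcases Finset.mem_union.1 hσ with h | h
    · rw [h1 σ h, hs.2.1 σ h]
    · rw [h0 σ h, hs.2.2 σ h]
  have h3 := dirichletForm_self_nonneg β H (fun σ => f σ - u σ)
  rw [dirichletForm_sub_right, dirichletForm_comm, dirichletForm_sub_right,
    dirichletForm_comm β H (fun σ => f σ - u σ) u, dirichletForm_sub_right,
    dirichletForm_comm β H f u, h2] at h3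
  change 0 ≤ dirichletForm β H f f - capacity β H A B
    - (capacity β H A B - capacity β H A B) at h3
  linarith

/-- The capacity is the total charge of the equilibrium potential on `A`. -/
lemma capacity_eq_sum_charge :
    capacity β H A B = ∑ σ ∈ A, charge β H (equilibriumPotential β H A B) σ := by
  classical
  have hs := equilibriumPotential_solves (β := β) (H := H) hAB hA
  rw [capacity, hs.dirichletForm_congr (g' := fun σ => if σ ∈ A then 1 else 0),
    dirichletForm_eq_sum_charge]
  · simp
  · intro σ hσ
    by_cases h : σ ∈ A
    · rw [hs.2.1 σ h, if_pos h]
    · rw [hs.2.2 σ ((Finset.mem_union.1 hσ).resolve_left h), if_neg h]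

lemma equilibriumPotential_swap (hB : B.Nonempty) :
    equilibriumPotential β H B A = fun σ => 1 - equilibriumPotential β H A B σ := by
  have hs := equilibriumPotential_solves (β := β) (H := H) hAB hA
  refine (eq_equilibriumPotential hAB.symm hB ⟨fun σ hσ => ?_, fun σ hσ => ?_, fun σ hσ => ?_⟩).symm
  · have := hs.1 σ (by rwa [Finset.union_comm])
    simp only [generator] at this ⊢
    rw [← neg_eq_zero, ← this, ← Finset.sum_neg_distrib]
    exact Finset.sum_congr rfl fun _ _ => by ring
  · simp [hs.2.2 σ hσ]
  · simp [hs.2.1 σ hσ]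

lemma capacity_comm (hB : B.Nonempty) : capacity β H B A = capacity β H A B := by
  simp only [capacity, equilibriumPotential_swap hAB hA hB, dirichletForm, sub_sub_sub_cancel_left]
  congr 1
  exact Finset.sum_congr rfl fun σ _ => Finset.sum_congr rfl fun τ _ => by ring

lemma capacity_mono {A' B' : Finset (Config N)} (hA' : A' ⊆ A) (hA'' : A'.Nonempty)
    (hB : B' ⊆ B) : capacity β H A' B' ≤ capacity β H A B := by
  have hs := equilibriumPotential_solves (β := β) (H := H) hAB hA
  exact capacity_le_dirichletForm (hAB.mono hA' hB) hA'' (fun σ hσ => hs.2.1 σ (hA' hσ))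
    (fun σ hσ => hs.2.2 σ (hB hσ))

lemma capacity_pos (hB : B.Nonempty) : 0 < capacity β H A B := by
  have hs := equilibriumPotential_solves (β := β) (H := H) hAB hA
  by_contra! h0
  obtain ⟨a, ha⟩ := hA
  obtain ⟨b, hb⟩ := hB
  have := eq_of_dirichletForm_nonpos h0 a b
  rw [hs.2.1 a ha, hs.2.2 b hb] at this
  exact one_ne_zero this

lemma equilibriumPotential_nonneg (σ : Config N) : 0 ≤ equilibriumPotential β H A B σ := by
  have hs := equilibriumPotential_solves (β := β) (H := H) hAB hA
  set u := equilibriumPotential β H A B with hu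
  -- the negative part of `u` vanishes on the boundary, hence has energy zero
  have hb : ∀ σ ∈ A ∪ B, min (u σ) 0 = 0 := fun σ hσ => by
    rcases Finset.mem_union.1 hσ with h | h
    · rw [hs.2.1 σ h]; norm_num
    · rw [hs.2.2 σ h]; norm_num
  have h1 : dirichletForm β H u (fun σ => min (u σ) 0) = 0 := by
    rw [dirichletForm_eq_sum_charge]
    refine Finset.sum_eq_zero fun σ _ => ?_
    by_cases hσ : σ ∈ A ∪ B
    · rw [hb σ hσ, mul_zero]
    · rw [hs.charge_eq_zero hσ, zero_mul]
  have h2 : dirichletForm β H (fun σ => min (u σ) 0) (fun σ => min (u σ) 0) ≤ 0 :=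
    (dirichletForm_mono β H fun σ τ => min_sub_min_mul_le (u σ) (u τ) 0).trans h1.le
  obtain ⟨a, ha⟩ := hA
  have := eq_of_dirichletForm_nonpos h2 σ a
  rw [hb a (Finset.mem_union_left _ ha)] at this
  exact min_eq_right_iff.1 this

lemma equilibriumPotential_le_one (σ : Config N) : equilibriumPotential β H A B σ ≤ 1 := by
  rcases B.eq_empty_or_nonempty with rfl | hB
  · have : (fun _ : Config N => (1 : ℝ)) = equilibriumPotential β H A ∅ :=
      eq_equilibriumPotential hAB hA
        ⟨fun σ _ => by simp [generator], fun _ _ => rfl, fun σ hσ => by simp at hσ⟩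
    rw [← this]
  · have := equilibriumPotential_nonneg (β := β) (H := H) hAB.symm hB σ
    rw [equilibriumPotential_swap hAB hA hB] at this
    linarith

/-- Superlevel sets of an equilibrium potential have controlled capacity: truncate the potential at
the level `t`. -/
lemma capacity_superlevel_le {t : ℝ} (ht : 0 < t) (ht1 : t ≤ 1) {X B' : Finset (Config N)}
    (hX : X.Nonempty) (hXB : Disjoint X B') (hB' : B' ⊆ B)
    (hXt : ∀ σ ∈ X, t ≤ equilibriumPotential β H A B σ) :
    capacity β H X B' ≤ capacity β H A B / t := by
  have hs := equilibriumPotential_solves (β := β) (H := H) hAB hA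
  have h1 := capacity_le_dirichletForm (β := β) (H := H) (A := X) (B := B')
    (f := fun σ => t⁻¹ * min (equilibriumPotential β H A B σ) t) hXB hX
    (fun σ hσ => by rw [min_eq_right (hXt σ hσ), inv_mul_cancel₀ ht.ne'])
    (fun σ hσ => by rw [hs.2.2 σ (hB' hσ), min_eq_left ht.le, mul_zero])
  refine h1.trans ?_
  set u := equilibriumPotential β H A B with hu
  have h2 : dirichletForm β H u (fun σ => min (u σ) t) = t * capacity β H A B := by
    rw [capacity, ← dirichletForm_smul_right, ← hu]
    refine hs.dirichletForm_congr fun σ hσ => ?_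
    rcases Finset.mem_union.1 hσ with h | h
    · rw [hs.2.1 σ h, min_eq_right ht1, mul_one]
    · rw [hs.2.2 σ h, min_eq_left ht.le, mul_zero]
  have h3 : dirichletForm β H (fun σ => min (u σ) t) (fun σ => min (u σ) t)
      ≤ t * capacity β H A B :=
    (dirichletForm_mono β H fun σ τ => min_sub_min_mul_le (u σ) (u τ) t).trans h2.le
  rw [dirichletForm_smul_right, dirichletForm_comm, dirichletForm_smul_right]
  calc t⁻¹ * (t⁻¹ * dirichletForm β H (fun σ => min (u σ) t) (fun σ => min (u σ) t))
      ≤ t⁻¹ * (t⁻¹ * (t * capacity β H A B)) := by gcongr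
    _ = capacity β H A B / t := by field_simp

lemma charge_nonneg {σ : Config N} (hσ : σ ∈ A) :
    0 ≤ charge β H (equilibriumPotential β H A B) σ := by
  have hs := equilibriumPotential_solves (β := β) (H := H) hAB hA
  rw [charge_eq_sum]
  refine Finset.sum_nonneg fun τ _ => mul_nonneg (conductance_nonneg β H σ τ) ?_
  rw [hs.2.1 σ hσ]
  linarith [equilibriumPotential_le_one (β := β) (H := H) hAB hA τ]

lemma charge_nonpos {σ : Config N} (hσ : σ ∈ B) :
    charge β H (equilibriumPotential β H A B) σ ≤ 0 := by
  have hs := equilibriumPotential_solves (β := β) (H := H) hAB hA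
  rw [charge_eq_sum]
  refine Finset.sum_nonpos fun τ _ => mul_nonpos_of_nonneg_of_nonpos
    (conductance_nonneg β H σ τ) ?_
  rw [hs.2.2 σ hσ]
  linarith [equilibriumPotential_nonneg (β := β) (H := H) hAB hA τ]

end Potential

/-! ### Return probabilities and capacities -/

section Rates

variable {N : ℕ} {β : ℝ} {H : Config N → ℝ}

/-- The sum of the rates over the `N` flips. -/
lemma totalRate_rate (σ : Config N) : (totalRate (rate β H) σ : ℝ)
    = ∑ k, Real.exp (-β * max (H (Function.update σ k (-σ k)) - H σ) 0) := by
  classical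
  have hinj : Function.Injective fun k => Function.update σ k (-σ k) := by
    intro k l hkl
    by_contra hne
    have h := congrFun hkl k
    simp only [Function.update_self, Function.update_of_ne hne] at h
    exact Int.units_ne_iff_eq_neg.2 (by rw [neg_neg]) h.symm
  have hsub : ∑ τ, (rate β H σ τ : ℝ)
      = ∑ τ ∈ Finset.univ.image fun k => Function.update σ k (-σ k), (rate β H σ τ : ℝ) := by
    refine (Finset.sum_subset (Finset.subset_univ _) fun τ _ hτ => ?_).symm
    rw [rate, if_neg, NNReal.coe_zero]
    rintro ⟨k, rfl⟩
    exact hτ (Finset.mem_image_of_mem _ (Finset.mem_univ k))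
  rw [totalRate, NNReal.coe_sum, hsub, Finset.sum_image fun _ _ _ _ h => hinj h]
  refine Finset.sum_congr rfl fun k _ => ?_
  rw [rate, if_pos ⟨k, rfl⟩, Real.coe_toNNReal _ (Real.exp_pos _).le]

lemma totalRate_le (hβ : 0 < β) (σ : Config N) : (totalRate (rate β H) σ : ℝ) ≤ N := by
  rw [totalRate_rate]
  refine (Finset.sum_le_card_nsmul _ _ 1 fun k _ => ?_).trans (by simp)
  rw [Real.exp_le_one_iff]
  have := mul_nonneg hβ.le (le_max_right (H (Function.update σ k (-σ k)) - H σ) 0)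
  linarith

lemma le_totalRate (hβ : 0 < β) {δ : ℝ} (hδ : 0 ≤ δ) (h : ∀ σ τ, IsFlip σ τ → H τ - H σ ≤ δ)
    (σ : Config N) : N * Real.exp (-β * δ) ≤ totalRate (rate β H) σ := by
  rw [totalRate_rate]
  have := Finset.card_nsmul_le_sum (Finset.univ : Finset (Fin N))
    (fun k => Real.exp (-β * max (H (Function.update σ k (-σ k)) - H σ) 0)) (Real.exp (-β * δ))
    fun k _ => Real.exp_le_exp.2 (by
      have := mul_le_mul_of_nonneg_left (max_le (h σ _ ⟨k, rfl⟩) hδ) hβ.le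
      linarith)
  simpa using this

lemma totalRate_ne_zero (hN : 0 < N) (σ : Config N) : totalRate (rate β H) σ ≠ 0 := by
  have : (0 : ℝ) < totalRate (rate β H) σ := by
    rw [totalRate_rate]
    exact Finset.sum_pos (fun _ _ => Real.exp_pos _) ⟨⟨0, hN⟩, Finset.mem_univ _⟩
  exact_mod_cast this.ne'

lemma generator_eq (f : Config N → ℝ) (σ : Config N) : generator β H f σ
    = ∑ τ, (rate β H σ τ : ℝ) * f τ - totalRate (rate β H) σ * f σ := by
  rw [generator, totalRate, NNReal.coe_sum, Finset.sum_mul, ← Finset.sum_sub_distrib]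
  exact Finset.sum_congr rfl fun _ _ => by ring

lemma hitBefore_nonneg (B A : Finset (Config N)) (σ : Config N) :
    0 ≤ hitBefore (rate β H) B A σ := measureReal_nonneg

lemma gibbsMass_mul_hitBeforeFrom {A : Finset (Config N)} (B : Finset (Config N))
    (hA : A.Nonempty) :
    gibbsMass β H A * hitBeforeFrom β H A B A
      = ∑ σ ∈ A, gibbs β H σ * hitBefore (rate β H) B A σ := by
  rw [hitBeforeFrom, Finset.mul_sum]
  refine Finset.sum_congr rfl fun σ _ => ?_
  rw [← mul_assoc, mul_div_cancel₀ _ (gibbsMass_pos β H hA).ne']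

/-- The hypercube is bipartite, so that any set of configurations contains a set without internal
edges that has at least half of its mass. -/
lemma exists_subset_no_flip {X : Finset (Config N)} (hX : X.Nonempty) :
    ∃ Y ⊆ X, Y.Nonempty ∧ (∀ σ ∈ Y, ∀ τ ∈ Y, ¬IsFlip σ τ) ∧
      gibbsMass β H X ≤ 2 * gibbsMass β H Y := by
  classical
  have hpar : ∀ σ τ : Config N, IsFlip σ τ → ∏ i, τ i = -∏ i, σ i := by
    rintro σ τ ⟨k, rfl⟩
    rw [Finset.prod_update_of_mem (Finset.mem_univ k), neg_mul, neg_inj,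
      Finset.sdiff_singleton_eq_erase, Finset.mul_prod_erase _ _ (Finset.mem_univ k)]
  have hne : ∀ u : ℤˣ, u ≠ -u := fun u => Int.units_ne_iff_eq_neg.2 (by rw [neg_neg])
  have hsum : gibbsMass β H (X.filter fun σ => ∏ i, σ i = 1)
      + gibbsMass β H (X.filter fun σ => ¬∏ i, σ i = 1) = gibbsMass β H X :=
    Finset.sum_filter_add_sum_filter_not X _ _
  have hpos := gibbsMass_pos β H hX
  have hnon : ∀ Y : Finset (Config N), gibbsMass β H X ≤ 2 * gibbsMass β H Y → Y.Nonempty := by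
    intro Y hY
    by_contra h
    rw [Finset.not_nonempty_iff_eq_empty] at h
    rw [h, gibbsMass, gibbsMass, Finset.sum_empty, mul_zero] at hY
    exact absurd hpos hY.not_gt
  rcases le_total (gibbsMass β H (X.filter fun σ => ∏ i, σ i = 1))
    (gibbsMass β H (X.filter fun σ => ¬∏ i, σ i = 1)) with h | h
  · refine ⟨_, Finset.filter_subset (fun σ => ¬∏ i, σ i = 1) X, hnon _ (by linarith), ?_,
      by linarith⟩
    intro σ hσ τ hτ hf
    have h1 := (Finset.mem_filter.1 hσ).2
    have h2 := (Finset.mem_filter.1 hτ).2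
    rw [hpar σ τ hf, (Int.units_eq_one_or (∏ i, σ i)).resolve_left h1, neg_neg] at h2
    exact h2 rfl
  · refine ⟨_, Finset.filter_subset (fun σ => ∏ i, σ i = 1) X, hnon _ (by linarith), ?_,
      by linarith⟩
    intro σ hσ τ hτ hf
    have h1 := (Finset.mem_filter.1 hσ).2
    have h2 := (Finset.mem_filter.1 hτ).2
    rw [hpar σ τ hf, h1] at h2
    exact hne 1 h2.symm

variable (hN : 0 < N) {A B : Finset (Config N)} (hAB : Disjoint A B) (hB : B.Nonempty)
include hN hAB hB

/-- Off the two sets, the probability to hit `B` before `A` is the equilibrium potential. -/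
lemma hitBefore_eq_equilibriumPotential {σ : Config N} (hσ : σ ∉ A ∪ B) :
    hitBefore (rate β H) B A σ = equilibriumPotential β H B A σ := by
  classical
  have hsol : SolvesDirichlet β H B A
      fun σ => if σ ∈ B then 1 else if σ ∈ A then 0 else hitBefore (rate β H) B A σ := by
    refine ⟨fun σ hσ => ?_, fun σ hσ => if_pos hσ, fun σ hσ => ?_⟩
    · simp only [Finset.mem_union, not_or] at hσ
      rw [generator_eq, if_neg hσ.1, if_neg hσ.2,
        totalRate_mul_hitBefore (rate β H) (totalRate_ne_zero hN) hAB hσ.1, sub_eq_zero]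
      refine Finset.sum_congr rfl fun τ _ => ?_
      simp [afterStep, hσ.2]
    · simp [Finset.disjoint_left.1 hAB hσ, hσ]
  rw [← eq_equilibriumPotential hAB.symm hB hsol]
  simp only [Finset.mem_union, not_or] at hσ
  simp [hσ.1, hσ.2]

/-- Started in `A`, the chain returns to `A` only after having left it, so that the escape
probability exceeds the one that is computed from the first jump alone. -/
lemma charge_le_hitBefore (hA : A.Nonempty) {σ : Config N} (hσ : σ ∈ A) :
    charge β H (equilibriumPotential β H A B) σ
      ≤ gibbs β H σ * (totalRate (rate β H) σ * hitBefore (rate β H) B A σ) := by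
  classical
  have hs := equilibriumPotential_solves (β := β) (H := H) hAB.symm hB
  rw [equilibriumPotential_swap hAB.symm hB hA, charge_eq_sum,
    totalRate_mul_hitBefore (rate β H) (totalRate_ne_zero hN) hAB (Finset.disjoint_left.1 hAB hσ),
    Finset.mul_sum]
  refine Finset.sum_le_sum fun τ _ => ?_
  rw [conductance, mul_assoc, hs.2.2 σ hσ]
  refine mul_le_mul_of_nonneg_left (mul_le_mul_of_nonneg_left ?_ (NNReal.coe_nonneg _))
    (gibbs_pos β H σ).le
  rw [afterStep]
  split_ifs with h1 h2
  · rw [hs.2.1 τ h1]; norm_num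
  · exact absurd hσ h2.2
  · by_cases h3 : τ ∈ A
    · rw [hs.2.2 τ h3]
      simpa using hitBefore_nonneg B A τ
    · rw [hitBefore_eq_equilibriumPotential hN hAB hB (by simp [h1, h3])]
      linarith

/-- If no flip leads from `A` to `A`, the escape probability is computed from the first jump. -/
lemma charge_eq_hitBefore (hA : A.Nonempty) (hflip : ∀ σ ∈ A, ∀ τ ∈ A, ¬IsFlip σ τ)
    {σ : Config N} (hσ : σ ∈ A) :
    charge β H (equilibriumPotential β H A B) σ
      = gibbs β H σ * (totalRate (rate β H) σ * hitBefore (rate β H) B A σ) := by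
  classical
  have hs := equilibriumPotential_solves (β := β) (H := H) hAB.symm hB
  rw [equilibriumPotential_swap hAB.symm hB hA, charge_eq_sum,
    totalRate_mul_hitBefore (rate β H) (totalRate_ne_zero hN) hAB (Finset.disjoint_left.1 hAB hσ),
    Finset.mul_sum]
  refine Finset.sum_congr rfl fun τ _ => ?_
  rw [conductance, mul_assoc, hs.2.2 σ hσ]
  by_cases h3 : τ ∈ A
  · rw [rate, if_neg (hflip σ hσ τ h3)]; simp
  · congr 2
    rw [afterStep]
    split_ifs with h1 h2
    · rw [hs.2.1 τ h1]; norm_num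
    · exact absurd hσ h2.2
    · rw [hitBefore_eq_equilibriumPotential hN hAB hB (by simp [h1, h3])]
      ring

lemma capacity_le_hitBeforeFrom (hβ : 0 < β) (hA : A.Nonempty) :
    capacity β H A B ≤ N * (gibbsMass β H A * hitBeforeFrom β H A B A) := by
  rw [gibbsMass_mul_hitBeforeFrom B hA, capacity_eq_sum_charge hAB hA, Finset.mul_sum]
  refine Finset.sum_le_sum fun σ hσ => (charge_le_hitBefore hN hAB hB hA hσ).trans ?_
  rw [mul_left_comm]
  refine mul_le_mul_of_nonneg_right (totalRate_le hβ σ) ?_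
  exact mul_nonneg (gibbs_pos β H σ).le (hitBefore_nonneg B A σ)

lemma hitBeforeFrom_le_capacity (hβ : 0 < β) (hA : A.Nonempty)
    (hflip : ∀ σ ∈ A, ∀ τ ∈ A, ¬IsFlip σ τ) {δ : ℝ} (hδ : 0 ≤ δ)
    (h : ∀ σ τ, IsFlip σ τ → H τ - H σ ≤ δ) :
    N * Real.exp (-β * δ) * (gibbsMass β H A * hitBeforeFrom β H A B A) ≤ capacity β H A B := by
  rw [gibbsMass_mul_hitBeforeFrom B hA, capacity_eq_sum_charge hAB hA, Finset.mul_sum]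
  refine Finset.sum_le_sum fun σ hσ => ?_
  rw [charge_eq_hitBefore hN hAB hB hA hflip hσ, mul_left_comm (gibbs β H σ)]
  refine mul_le_mul_of_nonneg_right (le_totalRate hβ hδ h σ) ?_
  exact mul_nonneg (gibbs_pos β H σ).le (hitBefore_nonneg B A σ)

end Rates

/-! ### Metastability in terms of capacities -/

section Metastability

variable {N : ℕ} {β : ℝ} {H : Config N → ℝ} {K : ℕ}

lemma subset_unionAll (M : Fin K → Finset (Config N)) (j : Fin K) : M j ⊆ unionAll M :=
  Finset.subset_biUnion_of_mem M (Finset.mem_univ j)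

lemma unionAll_sdiff_nonempty (hK : 2 ≤ K) {M : Fin K → Finset (Config N)}
    (hne : ∀ j, (M j).Nonempty) (hd : ∀ j k, j ≠ k → Disjoint (M j) (M k)) (j : Fin K) :
    (unionAll M \ M j).Nonempty := by
  have : Nontrivial (Fin K) := Fin.nontrivial_iff_two_le.2 hK
  obtain ⟨k, hk⟩ := exists_ne j
  obtain ⟨σ, hσ⟩ := hne k
  exact ⟨σ, Finset.mem_sdiff.2 ⟨subset_unionAll M k hσ, Finset.disjoint_left.1 (hd k j hk) hσ⟩⟩

/-- Metastability in terms of capacities. The rates cancel up to `exp (β * δ)`, since each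
configuration has `N` neighbours; the factor `2` comes from passing to an edge-free subset of
`X`. -/
lemma IsMetastable.capacity_mul_le (hβ : 0 < β) (hN : 0 < N) (hK : 2 ≤ K) {δ : ℝ} (hδ : 0 ≤ δ)
    (h : ∀ σ τ, IsFlip σ τ → H τ - H σ ≤ δ) {ρ : ℝ} (hρ : 0 ≤ ρ)
    {M : Fin K → Finset (Config N)} (hM : IsMetastable β H ρ M) (j : Fin K)
    {X : Finset (Config N)} (hX : X.Nonempty) (hXM : Disjoint X (unionAll M)) :
    K * (capacity β H (M j) (unionAll M \ M j) * gibbsMass β H X)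
      ≤ 2 * Real.exp (β * δ) * ρ * (gibbsMass β H (M j) * capacity β H X (unionAll M)) := by
  obtain ⟨hne, hd, hcov, hle⟩ := hM
  have hN' : (0 : ℝ) < N := by exact_mod_cast hN
  have hU : (unionAll M).Nonempty := (hne j).mono (subset_unionAll M j)
  set f : Fin K → ℝ := fun j => hitBeforeFrom β H (M j) (unionAll M \ M j) (M j) with hf
  set g : {X : Finset (Config N) // X.Nonempty ∧ Disjoint X (unionAll M)} → ℝ :=
    fun X => hitBeforeFrom β H X (unionAll M) X with hg
  obtain ⟨Y, hYX, hY, hflip, hmass⟩ := exists_subset_no_flip (β := β) (H := H) hX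
  have hYM : Disjoint Y (unionAll M) := hXM.mono_left hYX
  have : Nonempty {X : Finset (Config N) // X.Nonempty ∧ Disjoint X (unionAll M)} :=
    ⟨⟨X, hX, hXM⟩⟩
  have hnum : f j ≤ ⨆ j, f j := le_ciSup (Set.finite_range f).bddAbove j
  have hden : ⨅ X, g X ≤ g ⟨Y, hY, hYM⟩ := ciInf_le (Set.finite_range g).bddBelow _
  have hdpos : 0 < ⨅ X, g X := by
    obtain ⟨Z, hZ⟩ := exists_eq_ciInf_of_finite (f := g)
    rw [← hZ]
    have h1 := capacity_le_hitBeforeFrom (H := H) hN Z.2.2 hU hβ Z.2.1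
    have h2 := (capacity_pos (β := β) (H := H) Z.2.2 Z.2.1 hU).trans_le h1
    exact pos_of_mul_pos_right (pos_of_mul_pos_right h2 hN'.le) (gibbsMass_pos β H Z.2.1).le
  have hkey : K * f j ≤ ρ * g ⟨Y, hY, hYM⟩ := by
    refine (mul_le_mul_of_nonneg_left hnum (Nat.cast_nonneg K)).trans ?_
    exact ((div_le_iff₀ hdpos).1 hle).trans (mul_le_mul_of_nonneg_left hden hρ)
  have h1 := capacity_le_hitBeforeFrom (H := H) hN
    (Finset.disjoint_sdiff : Disjoint (M j) (unionAll M \ M j))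
    (unionAll_sdiff_nonempty hK hne hd j) hβ (hne j)
  have h2 := (hitBeforeFrom_le_capacity hN hYM hU hβ hY hflip hδ h).trans
    (capacity_mono hXM hX hYX hY subset_rfl)
  have hmj := gibbsMass_pos β H (hne j)
  have hmX := gibbsMass_pos β H hX
  have hmY := gibbsMass_pos β H hY
  have hexp : Real.exp (β * δ) * Real.exp (-β * δ) = 1 := by
    rw [← Real.exp_add]; simp
  have he := Real.exp_pos (β * δ)
  calc (K : ℝ) * (capacity β H (M j) (unionAll M \ M j) * gibbsMass β H X)
      ≤ K * ((N * (gibbsMass β H (M j) * f j)) * gibbsMass β H X) := by gcongr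
    _ = N * gibbsMass β H (M j) * gibbsMass β H X * (K * f j) := by ring
    _ ≤ N * gibbsMass β H (M j) * gibbsMass β H X * (ρ * g ⟨Y, hY, hYM⟩) := by gcongr
    _ ≤ N * gibbsMass β H (M j) * (2 * gibbsMass β H Y) * (ρ * g ⟨Y, hY, hYM⟩) := by
        have : 0 ≤ ρ * g ⟨Y, hY, hYM⟩ := mul_nonneg hρ (hdpos.le.trans hden)
        gcongr
    _ = 2 * Real.exp (β * δ) * ρ * (gibbsMass β H (M j) *
          (N * Real.exp (-β * δ) * (gibbsMass β H Y * g ⟨Y, hY, hYM⟩))) := by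
        linear_combination (-2 * N * gibbsMass β H (M j) * gibbsMass β H Y *
          (ρ * g ⟨Y, hY, hYM⟩)) * hexp
    _ ≤ _ := by gcongr

/-- The equilibrium potentials of the metastable sets form a partition of unity. -/
lemma sum_equilibriumPotential {M : Fin K → Finset (Config N)} (hU : (unionAll M).Nonempty)
    (hne : ∀ j, (M j).Nonempty) (hd : ∀ j k, j ≠ k → Disjoint (M j) (M k)) (σ : Config N) :
    ∑ l, equilibriumPotential β H (M l) (unionAll M \ M l) σ = 1 := by
  have hs := fun l => equilibriumPotential_solves (β := β) (H := H)
    (Finset.disjoint_sdiff : Disjoint (M l) (unionAll M \ M l)) (hne l)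
  have h1 : SolvesDirichlet β H (unionAll M) ∅
      fun σ => ∑ l, equilibriumPotential β H (M l) (unionAll M \ M l) σ := by
    refine ⟨fun σ hσ => ?_, fun σ hσ => ?_, fun σ hσ => by simp at hσ⟩
    · have : ∀ l, generator β H (equilibriumPotential β H (M l) (unionAll M \ M l)) σ = 0 :=
        fun l => (hs l).1 σ (by
          rw [Finset.union_sdiff_of_subset (subset_unionAll M l)]
          simpa using hσ)
      rw [← Finset.sum_eq_zero fun l (_ : l ∈ Finset.univ) => this l]
      simp only [generator]
      rw [Finset.sum_comm]
      simp only [← Finset.mul_sum, Finset.sum_sub_distrib]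
    · obtain ⟨j, -, hj⟩ := Finset.mem_biUnion.1 hσ
      beta_reduce
      rw [Finset.sum_eq_single j, (hs j).2.1 σ hj]
      · intro l _ hl
        exact (hs l).2.2 σ (Finset.mem_sdiff.2
          ⟨hσ, Finset.disjoint_left.1 (hd j l hl.symm) hj⟩)
      · simp
  have h2 : SolvesDirichlet β H (unionAll M) ∅ fun _ => 1 :=
    ⟨fun σ _ => by simp [generator], fun _ _ => rfl, fun σ hσ => by simp at hσ⟩
  exact congrFun ((existsUnique_solvesDirichlet β H (Finset.disjoint_empty_right _)
    (by simpa using hU)).unique h1 h2) σ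

/-- For a set `X` in the valley of `M j`, a fraction `1 / K` of the capacity to all the metastable
sets already is the capacity to `M j`: by reversibility, the flow of the equilibrium potential of
`(X, unionAll M)` into `M j` is an average over `X` of the probability to hit `M j` first. -/
lemma IsMetastablePartition.capacity_le (hN : 0 < N) (hK : 2 ≤ K)
    {M S : Fin K → Finset (Config N)}
    (hne : ∀ j, (M j).Nonempty) (hd : ∀ j k, j ≠ k → Disjoint (M j) (M k))
    (hS : IsMetastablePartition β H M S) (j : Fin K)
    {X : Finset (Config N)} (hX : X.Nonempty) (hXS : X ⊆ S j) (hXM : Disjoint X (unionAll M)) :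
    capacity β H X (unionAll M) ≤ K * capacity β H X (M j) := by
  have hK0 : (0 : ℝ) < K := by exact_mod_cast (by omega : 0 < K)
  have hU : (unionAll M).Nonempty := (hne j).mono (subset_unionAll M j)
  have hMj := subset_unionAll M j
  have hdis : Disjoint (M j) (unionAll M \ M j) := Finset.disjoint_sdiff
  have hun : M j ∪ (unionAll M \ M j) = unionAll M := Finset.union_sdiff_of_subset hMj
  set g := equilibriumPotential β H (M j) (unionAll M \ M j) with hg
  set φ := equilibriumPotential β H X (unionAll M) with hφ
  set f := equilibriumPotential β H X (M j) with hf
  have hgs : SolvesDirichlet β H (M j) (unionAll M \ M j) g :=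
    equilibriumPotential_solves hdis (hne j)
  have hφs : SolvesDirichlet β H X (unionAll M) φ := equilibriumPotential_solves hXM hX
  have hXj : Disjoint X (M j) := hXM.mono_right hMj
  have hfs : SolvesDirichlet β H X (M j) f := equilibriumPotential_solves hXj hX
  have hf1 : ∀ σ, f σ ≤ 1 := equilibriumPotential_le_one hXj hX
  have hgX : ∀ σ ∈ X, 1 / (K : ℝ) ≤ g σ := by
    intro σ hσ
    have hσM : σ ∉ unionAll M := Finset.disjoint_left.1 hXM hσ
    have hhit : ∀ l, hitBefore (rate β H) (M l) (unionAll M \ M l) σ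
        = equilibriumPotential β H (M l) (unionAll M \ M l) σ := fun l =>
      hitBefore_eq_equilibriumPotential hN Finset.sdiff_disjoint (hne l) (by
        rw [Finset.union_comm, Finset.union_sdiff_of_subset (subset_unionAll M l)]
        exact hσM)
    have hle : ∀ l, equilibriumPotential β H (M l) (unionAll M \ M l) σ ≤ g σ := by
      intro l
      by_cases hl : l = j
      · rw [hl]
      · rcases (hS.2.2 j).2 σ (hXS hσ) with h | h
        · exact absurd (hMj h) hσM
        · rw [hg, ← hhit l, ← hhit j]
          exact h.2 l hl
    rw [div_le_iff₀' hK0, ← sum_equilibriumPotential (β := β) (H := H) hU hne hd σ]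
    simpa using Finset.sum_le_sum fun l (_ : l ∈ Finset.univ) => hle l
  -- `g` is harmonic off the metastable sets, where `φ` vanishes
  have hgφ : dirichletForm β H φ g = 0 := by
    rw [dirichletForm_comm, dirichletForm_eq_sum_charge]
    refine Finset.sum_eq_zero fun σ _ => ?_
    by_cases hσ : σ ∈ unionAll M
    · rw [hφs.2.2 σ hσ, mul_zero]
    · rw [hgs.charge_eq_zero (by rwa [hun]), zero_mul]
  have hφ1 : dirichletForm β H φ (fun _ => 1) = 0 := by
    simp [dirichletForm]
  have hfφ : capacity β H X (M j) = dirichletForm β H φ f := by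
    rw [dirichletForm_comm β H φ]
    refine hfs.dirichletForm_congr fun σ hσ => ?_
    rcases Finset.mem_union.1 hσ with h | h
    · rw [hφs.2.1 σ h, ← hf, hfs.2.1 σ h]
    · rw [hφs.2.2 σ (hMj h), ← hf, hfs.2.2 σ h]
  have hcapX : capacity β H X (unionAll M)
      = dirichletForm β H φ (fun σ => if σ ∈ X then 1 else 0) := by
    rw [capacity_eq_sum_charge hXM hX, dirichletForm_eq_sum_charge]
    simp [← hφ]
  -- a comparison of boundary values, as the charge of `φ` is positive on `X` and negative on the
  -- metastable sets
  have hmain : dirichletForm β H φ (fun σ => (1 - g σ) - -(1 / (K : ℝ)) * if σ ∈ X then 1 else 0)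
      ≤ dirichletForm β H φ f := by
    rw [dirichletForm_eq_sum_charge, dirichletForm_eq_sum_charge]
    refine Finset.sum_le_sum fun σ _ => ?_
    by_cases hσX : σ ∈ X
    · refine mul_le_mul_of_nonneg_left ?_ (charge_nonneg hXM hX hσX)
      rw [if_pos hσX, hfs.2.1 σ hσX]
      linarith [hgX σ hσX]
    · by_cases hσ : σ ∈ unionAll M
      · refine mul_le_mul_of_nonpos_left ?_ (charge_nonpos hXM hX hσ)
        rw [if_neg hσX]
        by_cases hσj : σ ∈ M j
        · rw [hgs.2.1 σ hσj, hfs.2.2 σ hσj]; simp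
        · rw [hgs.2.2 σ (Finset.mem_sdiff.2 ⟨hσ, hσj⟩)]
          simpa using hf1 σ
      · rw [hφs.charge_eq_zero (by simp [hσX, hσ]), zero_mul, zero_mul]
  rw [dirichletForm_sub_right, dirichletForm_sub_right, dirichletForm_smul_right, hgφ, hφ1,
    ← hcapX, ← hfφ] at hmain
  have : capacity β H X (unionAll M) / K ≤ capacity β H X (M j) := by
    rw [div_eq_mul_one_div]
    linarith
  rwa [div_le_iff₀' hK0] at this

end Metastability

/-! ### Comparison of two Hamiltonians -/

section Comparison

variable {N : ℕ} {β : ℝ} {H H' : Config N → ℝ} {a : ℝ}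

lemma exp_div_sum_exp_le (hβ : 0 < β) (h : ∀ σ, |H σ - H' σ| ≤ a) {x y : ℝ} (hxy : |x - y| ≤ a) :
    Real.exp (-β * x) / ∑ σ, Real.exp (-β * H σ)
      ≤ Real.exp (2 * β * a) * (Real.exp (-β * y) / ∑ σ, Real.exp (-β * H' σ)) := by
  have hle : ∀ x y : ℝ, |x - y| ≤ a → Real.exp (-β * x) ≤ Real.exp (β * a) * Real.exp (-β * y) := by
    intro x y hxy
    rw [← Real.exp_add]
    refine Real.exp_le_exp.2 ?_
    have := mul_le_mul_of_nonneg_left ((neg_le_abs _).trans hxy) hβ.le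
    linarith
  have hsum : ∑ σ, Real.exp (-β * H' σ) ≤ Real.exp (β * a) * ∑ σ, Real.exp (-β * H σ) := by
    rw [Finset.mul_sum]
    exact Finset.sum_le_sum fun σ _ => hle _ _ (by rw [abs_sub_comm]; exact h σ)
  rw [div_le_iff₀ (sum_exp_pos β H)]
  have hZ := sum_exp_pos β H'
  have h2 : Real.exp (2 * β * a) = Real.exp (β * a) * Real.exp (β * a) := by
    rw [← Real.exp_add]; ring_nf
  calc Real.exp (-β * x) ≤ Real.exp (β * a) * Real.exp (-β * y) := hle x y hxy
    _ = Real.exp (β * a) * (Real.exp (-β * y) / ∑ σ, Real.exp (-β * H' σ))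
          * ∑ σ, Real.exp (-β * H' σ) := by field_simp
    _ ≤ Real.exp (β * a) * (Real.exp (-β * y) / ∑ σ, Real.exp (-β * H' σ))
          * (Real.exp (β * a) * ∑ σ, Real.exp (-β * H σ)) := by gcongr
    _ = _ := by rw [h2]; ring

variable (hβ : 0 < β) (h : ∀ σ, |H σ - H' σ| ≤ a)
include hβ h

lemma gibbsMass_le (X : Finset (Config N)) :
    gibbsMass β H X ≤ Real.exp (2 * β * a) * gibbsMass β H' X := by
  rw [gibbsMass, gibbsMass, Finset.mul_sum]
  exact Finset.sum_le_sum fun σ _ => exp_div_sum_exp_le hβ h (h σ)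

lemma capacity_le {A B : Finset (Config N)} (hAB : Disjoint A B) (hA : A.Nonempty) :
    capacity β H A B ≤ Real.exp (2 * β * a) * capacity β H' A B := by
  classical
  have hs := equilibriumPotential_solves (β := β) (H := H') hAB hA
  refine (capacity_le_dirichletForm hAB hA hs.2.1 hs.2.2).trans ?_
  rw [capacity, dirichletForm, dirichletForm, mul_left_comm]
  simp only [Finset.mul_sum]
  refine Finset.sum_le_sum fun σ _ => Finset.sum_le_sum fun τ _ => ?_
  have hc : conductance β H σ τ ≤ Real.exp (2 * β * a) * conductance β H' σ τ := by
    rw [conductance_eq, conductance_eq]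
    split_ifs
    · exact exp_div_sum_exp_le hβ h ((abs_max_sub_max_le_max _ _ _ _).trans (max_le (h σ) (h τ)))
    · simp
  set u := equilibriumPotential β H' A B
  linarith [mul_le_mul_of_nonneg_right hc (mul_self_nonneg (u σ - u τ))]

end Comparison

/-! ### The norm of the equilibrium potential -/

/-- A weak-type bound on the superlevel sets of `g` gives a bound on its integral, up to a
logarithmic factor: sum over dyadic levels down to `2 ^ (-T)`. -/
lemma sum_mul_le_of_superlevel {V : Type*} (S : Finset V) {μ g : V → ℝ} (hμ : ∀ x, 0 ≤ μ x)
    (hS : ∑ x ∈ S, μ x ≤ 1) (hg : ∀ x, g x ≤ 1) {Q : ℝ}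
    (hQ : ∀ t, 0 < t → t ≤ 1 → ∑ x ∈ S.filter fun x => t ≤ g x, μ x ≤ Q / t) (T : ℕ) :
    ∑ x ∈ S, μ x * g x ≤ 2 * T * Q + (1 / 2) ^ T := by
  have hpt : ∀ x, g x ≤ ∑ n ∈ Finset.range T, (1 / 2 : ℝ) ^ n *
      (if (1 / 2 : ℝ) ^ (n + 1) ≤ g x then 1 else 0) + (1 / 2) ^ T := by
    intro x
    induction T with
    | zero => simpa using hg x
    | succ T ih =>
      have hnn : 0 ≤ ∑ n ∈ Finset.range T, (1 / 2 : ℝ) ^ n *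
          (if (1 / 2 : ℝ) ^ (n + 1) ≤ g x then 1 else 0) :=
        Finset.sum_nonneg fun n _ => mul_nonneg (by positivity) (by split_ifs <;> norm_num)
      have hp : (0 : ℝ) < (1 / 2) ^ (T + 1) := by positivity
      rw [Finset.sum_range_succ]
      split_ifs with h <;> linarith
  calc ∑ x ∈ S, μ x * g x
      ≤ ∑ x ∈ S, μ x * (∑ n ∈ Finset.range T, (1 / 2 : ℝ) ^ n *
          (if (1 / 2 : ℝ) ^ (n + 1) ≤ g x then 1 else 0) + (1 / 2) ^ T) :=
        Finset.sum_le_sum fun x _ => mul_le_mul_of_nonneg_left (hpt x) (hμ x)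
    _ = ∑ n ∈ Finset.range T, (1 / 2 : ℝ) ^ n *
          ∑ x ∈ S.filter fun x => (1 / 2 : ℝ) ^ (n + 1) ≤ g x, μ x
        + (∑ x ∈ S, μ x) * (1 / 2) ^ T := by
        simp only [mul_add, Finset.sum_add_distrib, Finset.sum_mul, Finset.mul_sum]
        congr 1
        rw [Finset.sum_comm]
        refine Finset.sum_congr rfl fun n _ => ?_
        rw [Finset.sum_filter]
        refine Finset.sum_congr rfl fun x _ => ?_
        split_ifs <;> ring
    _ ≤ ∑ n ∈ Finset.range T, 2 * Q + 1 * (1 / 2) ^ T := by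
        refine add_le_add (Finset.sum_le_sum fun n _ => ?_) (by gcongr)
        have h1 := mul_le_mul_of_nonneg_left (hQ ((1 / 2) ^ (n + 1)) (by positivity)
          (pow_le_one₀ (by norm_num) (by norm_num))) (by positivity : (0 : ℝ) ≤ (1 / 2) ^ n)
        refine h1.trans (le_of_eq ?_)
        rw [pow_succ]
        field_simp
    _ = 2 * T * Q + (1 / 2) ^ T := by
        rw [Finset.sum_const, Finset.card_range, nsmul_eq_mul]; ring

section Norm

variable {N : ℕ} {β : ℝ} {K : ℕ}

lemma IsMetastablePartition.mem_of_mem {H : Config N → ℝ} {M S : Fin K → Finset (Config N)}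
    (hS : IsMetastablePartition β H M S) {j : Fin K} {σ : Config N} (hσ : σ ∈ S j)
    (hσM : σ ∈ unionAll M) : σ ∈ M j := by
  obtain ⟨k, -, hk⟩ := Finset.mem_biUnion.1 hσM
  by_cases hkj : k = j
  · exact hkj ▸ hk
  · exact absurd hσ (Finset.disjoint_left.1 (hS.1 k j hkj) ((hS.2.2 k).1 hk))

/-- If the masses of subsets of `S` are controlled by their capacities to `D`, an equilibrium
potential that vanishes on `D` has small integral over `S`. -/
lemma sum_gibbs_mul_equilibriumPotential_le {H : Config N → ℝ} {A B D S U : Finset (Config N)}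
    (hAB : Disjoint A B) (hA : A.Nonempty) (hB : B.Nonempty) (hDB : D ⊆ B) (hSU : S ∩ U ⊆ D)
    (hDU : D ⊆ U) {Q : ℝ} (hQ0 : 0 ≤ Q)
    (hQ : ∀ X ⊆ S, X.Nonempty → Disjoint X U →
      gibbsMass β H X * capacity β H A B ≤ Q * capacity β H X D) (T : ℕ) :
    ∑ σ ∈ S, gibbs β H σ * equilibriumPotential β H A B σ ≤ 2 * T * Q + (1 / 2) ^ T := by
  have hs := equilibriumPotential_solves (β := β) (H := H) hAB hA
  refine sum_mul_le_of_superlevel S (fun σ => (gibbs_pos β H σ).le) (gibbsMass_le_one β H S)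
    (equilibriumPotential_le_one hAB hA) (fun t ht ht1 => ?_) T
  set X := S.filter fun σ => t ≤ equilibriumPotential β H A B σ with hXdef
  rcases X.eq_empty_or_nonempty with h | hX
  · rw [h, Finset.sum_empty]
    exact div_nonneg hQ0 ht.le
  have hXU : Disjoint X U := by
    refine Finset.disjoint_left.2 fun σ hσ hσU => ?_
    obtain ⟨h1, h2⟩ := Finset.mem_filter.1 hσ
    rw [hs.2.2 σ (hDB (hSU (Finset.mem_inter.2 ⟨h1, hσU⟩)))] at h2
    exact absurd ht h2.not_gt
  have hcap := capacity_pos (β := β) (H := H) hAB hA hB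
  have h1 := hQ X (Finset.filter_subset _ _) hX hXU
  have h2 := capacity_superlevel_le (β := β) (H := H) hAB hA ht ht1 hX (hXU.mono_right hDU) hDB
    fun σ hσ => (Finset.mem_filter.1 hσ).2
  refine le_of_mul_le_mul_right (h1.trans ((mul_le_mul_of_nonneg_left h2 hQ0).trans_eq ?_)) hcap
  ring

/-- Let the chain with Hamiltonian `H` be metastable, and let `H'` be uniformly close to `H`. The
norm of the equilibrium potential for `H'` is the mass for `H'` of the valley of `M i`, up to an
explicit error. -/
theorem abs_gibbsNorm_sub_gibbsMass_le {H H' : Config N → ℝ} (hβ : 0 < β) (hN : 0 < N)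
    (hK : 2 ≤ K) {a : ℝ} (hHH' : ∀ σ, |H' σ - H σ| ≤ a) {δ : ℝ} (hδ : 0 ≤ δ)
    (hflip : ∀ σ τ, IsFlip σ τ → H τ - H σ ≤ δ) {ρ ε : ℝ} (hρ : 0 ≤ ρ) (hε : 0 ≤ ε)
    {M S : Fin K → Finset (Config N)} (hM : IsMetastable β H ρ M)
    (hS : IsMetastablePartition β H M S) {i : Fin K} (hi : 0 < (i : ℕ))
    (hsmall : ∀ j, i < j → gibbsMass β H (S j) ≤ ε * gibbsMass β H (S i)) (T : ℕ) :
    |gibbsNorm β H' (equilibriumPotential β H' (M i) ((Finset.Iio i).biUnion M))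
        - gibbsMass β H' (S i)|
      ≤ K * (ε * Real.exp (2 * β * a) ^ 2 * gibbsMass β H' (S i)
        + (2 * T * (2 * Real.exp (β * δ) * ρ * Real.exp (2 * β * a) ^ 4 * gibbsMass β H' (S i))
          + (1 / 2) ^ T)) := by
  obtain ⟨hne, hd, -, -⟩ := id hM
  have hK0 : (0 : ℝ) < K := by exact_mod_cast (by omega : 0 < K)
  have hHH : ∀ σ, |H σ - H' σ| ≤ a := fun σ => by rw [abs_sub_comm]; exact hHH' σ
  set A := M i with hA
  set B := (Finset.Iio i).biUnion M with hB
  set U := unionAll M with hU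
  set E := Real.exp (2 * β * a) with hE
  have hE0 : 0 < E := Real.exp_pos _
  have hAB : Disjoint A B := by
    rw [hB, Finset.disjoint_biUnion_right]
    exact fun j hj => hd i j (Finset.mem_Iio.1 hj).ne'
  have hBne : B.Nonempty := by
    obtain ⟨σ, hσ⟩ := hne ⟨0, by omega⟩
    exact ⟨σ, Finset.mem_biUnion.2 ⟨_, Finset.mem_Iio.2 (Fin.lt_def.2 hi), hσ⟩⟩
  have hBU : B ⊆ U \ A := by
    intro σ hσ
    obtain ⟨j, -, hj⟩ := Finset.mem_biUnion.1 hσ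
    exact Finset.mem_sdiff.2 ⟨subset_unionAll M j hj, Finset.disjoint_right.1 hAB hσ⟩
  have hmS := gibbsMass_pos β H' ((hne i).mono (hS.2.2 i).1)
  set Q := 2 * Real.exp (β * δ) * ρ * E ^ 4 * gibbsMass β H' (S i) with hQdef
  have hQ0 : 0 ≤ Q := by positivity
  -- go to `H`, use metastability and the valley estimate there, and come back to `H'`
  have hQ : ∀ j, ∀ X ⊆ S j, X.Nonempty → Disjoint X U →
      gibbsMass β H' X * capacity β H' A B ≤ Q * capacity β H' X (M j) := by
    intro j X hXS hX hXU
    have hXj : Disjoint X (M j) := hXU.mono_right (subset_unionAll M j)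
    have h1 := gibbsMass_le hβ hHH' X
    have h2 := (capacity_le hβ hHH' hAB (hne i)).trans (mul_le_mul_of_nonneg_left
      (capacity_mono (β := β) (H := H) Finset.disjoint_sdiff (hne i) subset_rfl (hne i) hBU) hE0.le)
    have h3 := hM.capacity_mul_le hβ hN hK hδ hflip hρ i hX hXU
    have h4 := hS.capacity_le hN hK hne hd j hX hXS hXU
    have h5 := (gibbsMass_le hβ hHH A).trans
      (mul_le_mul_of_nonneg_left (gibbsMass_mono β H' (hS.2.2 i).1) hE0.le)
    have h6 := capacity_le hβ hHH hXj hX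
    have hc1 := capacity_pos (β := β) (H := H') hAB (hne i) hBne
    have hc2 := capacity_pos (β := β) (H := H') hXj hX (hne j)
    have hc3 := capacity_pos (β := β) (H := H) hXj hX (hne j)
    have hm := gibbsMass_pos β H hX
    have hmA := gibbsMass_pos β H (hne i)
    have he := Real.exp_pos (β * δ)
    refine le_of_mul_le_mul_left ?_ hK0
    calc (K : ℝ) * (gibbsMass β H' X * capacity β H' A B)
        ≤ K * ((E * gibbsMass β H X) * (E * capacity β H A (U \ A))) := by gcongr
      _ = E ^ 2 * (K * (capacity β H A (U \ A) * gibbsMass β H X)) := by ring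
      _ ≤ E ^ 2 * (2 * Real.exp (β * δ) * ρ * (gibbsMass β H A * capacity β H X U)) := by gcongr
      _ ≤ E ^ 2 * (2 * Real.exp (β * δ) * ρ *
            ((E * gibbsMass β H' (S i)) * (K * (E * capacity β H' X (M j))))) := by
          have : capacity β H X U ≤ K * (E * capacity β H' X (M j)) :=
            h4.trans (mul_le_mul_of_nonneg_left h6 hK0.le)
          gcongr
          exact dirichletForm_self_nonneg _ _ _
      _ = K * (Q * capacity β H' X (M j)) := by rw [hQdef]; ring
  have hSM : ∀ j, S j ∩ U ⊆ M j := fun j σ hσ =>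
    hS.mem_of_mem (Finset.mem_inter.1 hσ).1 (Finset.mem_inter.1 hσ).2
  set u := equilibriumPotential β H' A B with hu
  have hu0 : ∀ σ, 0 ≤ u σ := equilibriumPotential_nonneg hAB (hne i)
  have hu1 : ∀ σ, u σ ≤ 1 := equilibriumPotential_le_one hAB (hne i)
  have hμ := fun σ => (gibbs_pos β H' σ).le
  have hp : (0 : ℝ) < (1 / 2) ^ T := by positivity
  have hTQ : 0 ≤ 2 * T * Q := by positivity
  have hε' : 0 ≤ ε * E ^ 2 * gibbsMass β H' (S i) := by positivity
  have hsplit : gibbsNorm β H' u - gibbsMass β H' (S i)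
      = ∑ j, (∑ σ ∈ S j, gibbs β H' σ * u σ - if j = i then gibbsMass β H' (S i) else 0) := by
    have : gibbsNorm β H' u = ∑ j, ∑ σ ∈ S j, gibbs β H' σ * u σ := by
      rw [← Finset.sum_biUnion fun j _ k _ hjk => hS.1 j k hjk]
      change _ = ∑ σ ∈ unionAll S, _
      rw [hS.2.1]
      exact Finset.sum_congr rfl fun σ _ => by rw [abs_of_nonneg (hu0 σ)]
    rw [this, Finset.sum_sub_distrib]
    simp
  rw [hsplit]
  refine (Finset.abs_sum_le_sum_abs _ _).trans
    ((Finset.sum_le_card_nsmul _ _ _ fun j _ => ?_).trans_eq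
      (by rw [Finset.card_univ, Fintype.card_fin, nsmul_eq_mul]))
  have hsum0 : 0 ≤ ∑ σ ∈ S j, gibbs β H' σ * u σ :=
    Finset.sum_nonneg fun σ _ => mul_nonneg (hμ σ) (hu0 σ)
  rcases lt_trichotomy j i with hji | rfl | hij
  · rw [if_neg hji.ne, sub_zero, abs_of_nonneg hsum0]
    have := sum_gibbs_mul_equilibriumPotential_le (β := β) hAB (hne i) hBne
      (Finset.subset_biUnion_of_mem M (Finset.mem_Iio.2 hji)) (hSM j) (subset_unionAll M j) hQ0
      (hQ j) T
    linarith
  · -- on the valley of `M i`, the function `1 - u` is the equilibrium potential of `(B, A)`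
    have := sum_gibbs_mul_equilibriumPotential_le (β := β) hAB.symm hBne (hne j)
      subset_rfl (hSM j) (subset_unionAll M j) hQ0
      (by rw [capacity_comm hAB (hne j) hBne]; exact hQ j) T
    rw [equilibriumPotential_swap hAB (hne j) hBne] at this
    simp only [mul_sub, mul_one, Finset.sum_sub_distrib, ← hu] at this
    change gibbsMass β H' (S j) - _ ≤ _ at this
    have hle : ∑ σ ∈ S j, gibbs β H' σ * u σ ≤ gibbsMass β H' (S j) :=
      Finset.sum_le_sum fun σ _ => mul_le_of_le_one_right (hμ σ) (hu1 σ)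
    rw [if_pos rfl, abs_sub_comm, abs_of_nonneg (by linarith)]
    linarith
  · rw [if_neg hij.ne', sub_zero, abs_of_nonneg hsum0]
    have hle : ∑ σ ∈ S j, gibbs β H' σ * u σ ≤ gibbsMass β H' (S j) :=
      Finset.sum_le_sum fun σ _ => mul_le_of_le_one_right (hμ σ) (hu1 σ)
    have h1 := gibbsMass_le hβ hHH' (S j)
    have h2 := hsmall j hij
    have h3 := gibbsMass_le hβ hHH (S i)
    have h4 : gibbsMass β H' (S j) ≤ ε * E ^ 2 * gibbsMass β H' (S i) :=
      calc gibbsMass β H' (S j) ≤ E * (ε * (E * gibbsMass β H' (S i))) :=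
          h1.trans (mul_le_mul_of_nonneg_left
            (h2.trans (mul_le_mul_of_nonneg_left h3 hε)) hE0.le)
        _ = _ := by ring
    linarith

end Norm

/-! ### Bounds on the Hamiltonian -/

section Hamiltonian

variable {N : ℕ} {h kJ : ℝ} {J : ℕ → ℕ → ℝ}

lemma abs_spin (u : ℤˣ) : |((u : ℤ) : ℝ)| = 1 := by
  rcases Int.units_eq_one_or u with rfl | rfl <;> simp

lemma abs_hamiltonian_le (hN : 0 < N) (hk : 0 ≤ kJ) (hJ : ∀ i j, i < j → |J i j| ≤ kJ)
    (σ : Config N) : |hamiltonian N h J σ| ≤ N * (kJ + |h|) := by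
  have hN' : (0 : ℝ) < N := by exact_mod_cast hN
  have h1 : |∑ p : Fin N × Fin N with p.1 < p.2,
      J p.1 p.2 * ((σ p.1 : ℤ) : ℝ) * ((σ p.2 : ℤ) : ℝ)| ≤ N * N * kJ := by
    refine (Finset.abs_sum_le_sum_abs _ _).trans ?_
    refine (Finset.sum_le_card_nsmul _ _ kJ fun p hp => ?_).trans ?_
    · rw [abs_mul, abs_mul, abs_spin, abs_spin, mul_one, mul_one]
      exact hJ _ _ (Fin.lt_def.1 (Finset.mem_filter.1 hp).2)
    · rw [nsmul_eq_mul]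
      refine mul_le_mul_of_nonneg_right ?_ hk
      have := Finset.card_filter_le (Finset.univ : Finset (Fin N × Fin N)) fun p => p.1 < p.2
      simp only [Finset.card_univ, Fintype.card_prod, Fintype.card_fin] at this
      exact_mod_cast this
  have h2 : |∑ i, ((σ i : ℤ) : ℝ)| ≤ N := by
    refine (Finset.abs_sum_le_sum_abs _ _).trans ?_
    simp [abs_spin]
  rw [hamiltonian]
  refine (abs_sub _ _).trans ?_
  rw [abs_mul, abs_mul, abs_neg, abs_of_pos (one_div_pos.2 hN')]
  calc 1 / (N : ℝ) * _ + |h| * _ ≤ 1 / (N : ℝ) * (N * N * kJ) + |h| * N := by gcongr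
    _ = N * (kJ + |h|) := by field_simp

/-- A single flip changes the Hamiltonian by a bounded amount: only `2 N` of the pairs are
concerned. -/
lemma hamiltonian_sub_le (hN : 0 < N) (hk : 0 ≤ kJ) (hJ : ∀ i j, i < j → |J i j| ≤ kJ)
    {σ τ : Config N} (hf : IsFlip σ τ) :
    hamiltonian N h J τ - hamiltonian N h J σ ≤ 4 * kJ + 2 * |h| := by
  have hN' : (0 : ℝ) < N := by exact_mod_cast hN
  obtain ⟨k, hτ⟩ := hf
  have hoff : ∀ i, i ≠ k → τ i = σ i := fun i hi => by rw [hτ, Function.update_of_ne hi]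
  have h1 : |∑ p : Fin N × Fin N with p.1 < p.2,
      (J p.1 p.2 * ((σ p.1 : ℤ) : ℝ) * ((σ p.2 : ℤ) : ℝ)
        - J p.1 p.2 * ((τ p.1 : ℤ) : ℝ) * ((τ p.2 : ℤ) : ℝ))| ≤ 4 * kJ * N := by
    have hterm : ∀ p ∈ (Finset.univ : Finset (Fin N × Fin N)).filter (fun p => p.1 < p.2),
        |J p.1 p.2 * ((σ p.1 : ℤ) : ℝ) * ((σ p.2 : ℤ) : ℝ)
          - J p.1 p.2 * ((τ p.1 : ℤ) : ℝ) * ((τ p.2 : ℤ) : ℝ)|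
        ≤ 2 * kJ * ((if p.1 = k then 1 else 0) + if p.2 = k then 1 else 0) := by
      intro p hp
      have hb : |J p.1 p.2 * ((σ p.1 : ℤ) : ℝ) * ((σ p.2 : ℤ) : ℝ)
          - J p.1 p.2 * ((τ p.1 : ℤ) : ℝ) * ((τ p.2 : ℤ) : ℝ)| ≤ 2 * kJ := by
        refine (abs_sub _ _).trans ?_
        simp only [abs_mul, abs_spin, mul_one]
        linarith [hJ _ _ (Fin.lt_def.1 (Finset.mem_filter.1 hp).2)]
      by_cases h1 : p.1 = k
      · rw [if_pos h1]
        refine hb.trans (le_mul_of_one_le_right (by positivity) ?_)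
        split_ifs <;> norm_num
      · by_cases h2 : p.2 = k
        · rw [if_neg h1, if_pos h2]
          simpa using hb
        · simp [hoff _ h1, hoff _ h2, h1, h2]
    refine (Finset.abs_sum_le_sum_abs _ _).trans ((Finset.sum_le_sum hterm).trans ?_)
    refine (Finset.sum_le_sum_of_subset_of_nonneg (Finset.subset_univ _) fun p _ _ =>
      mul_nonneg (by positivity) (by split_ifs <;> norm_num)).trans (le_of_eq ?_)
    rw [← Finset.mul_sum, Finset.sum_add_distrib, Fintype.sum_prod_type, Fintype.sum_prod_type]
    have e1 : ∑ x : Fin N, ∑ _ : Fin N, (if x = k then (1 : ℝ) else 0) = N := by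
      rw [Finset.sum_comm]; simp
    have e2 : ∑ _ : Fin N, ∑ y : Fin N, (if y = k then (1 : ℝ) else 0) = N := by simp
    rw [e1, e2]
    ring
  have h2 : |∑ i, (((σ i : ℤ) : ℝ) - ((τ i : ℤ) : ℝ))| ≤ 2 := by
    rw [Finset.sum_eq_single k (fun i _ hi => by rw [hoff i hi, sub_self]) (by simp)]
    refine (abs_sub _ _).trans ?_
    rw [abs_spin, abs_spin]; norm_num
  have heq : hamiltonian N h J τ - hamiltonian N h J σ
      = 1 / (N : ℝ) * (∑ p : Fin N × Fin N with p.1 < p.2,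
          (J p.1 p.2 * ((σ p.1 : ℤ) : ℝ) * ((σ p.2 : ℤ) : ℝ)
            - J p.1 p.2 * ((τ p.1 : ℤ) : ℝ) * ((τ p.2 : ℤ) : ℝ)))
        + h * ∑ i, (((σ i : ℤ) : ℝ) - ((τ i : ℤ) : ℝ)) := by
    simp only [hamiltonian, Finset.sum_sub_distrib]
    ring
  rw [heq]
  refine (le_abs_self _).trans ((abs_add_le _ _).trans ?_)
  rw [abs_mul, abs_mul, abs_of_pos (one_div_pos.2 hN')]
  calc 1 / (N : ℝ) * _ + |h| * _ ≤ 1 / (N : ℝ) * (4 * kJ * N) + |h| * 2 := by gcongr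
    _ = 4 * kJ + 2 * |h| := by field_simp

lemma exp_le_gibbs {β b : ℝ} (hβ : 0 < β) {H : Config N → ℝ} (hH : ∀ σ, |H σ| ≤ N * b)
    (σ : Config N) : Real.exp (-((2 * β * b + Real.log 2) * N)) ≤ gibbs β H σ := by
  have hcard : (Fintype.card (Config N) : ℝ) = Real.exp (Real.log 2 * N) := by
    rw [mul_comm, Real.exp_nat_mul, Real.exp_log two_pos]
    simp
  have hZ : ∑ σ, Real.exp (-β * H σ) ≤ Real.exp (Real.log 2 * N) * Real.exp (β * (N * b)) := by
    refine (Finset.sum_le_card_nsmul _ _ (Real.exp (β * (N * b))) fun τ _ => ?_).trans_eq ?_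
    · refine Real.exp_le_exp.2 ?_
      have := mul_le_mul_of_nonneg_left ((neg_le_abs _).trans (hH τ)) hβ.le
      linarith
    · rw [Finset.card_univ, nsmul_eq_mul, hcard]
  rw [gibbs, le_div_iff₀ (sum_exp_pos β H)]
  refine (mul_le_mul_of_nonneg_left hZ (Real.exp_pos _).le).trans ?_
  rw [← Real.exp_add, ← Real.exp_add]
  refine Real.exp_le_exp.2 ?_
  have := mul_le_mul_of_nonneg_left ((le_abs_self _).trans (hH σ)) hβ.le
  linarith

end Hamiltonian

/-- The error terms of the deterministic estimate are exponentially small, for metastability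
parameters `exp (-k₁ N)`, `exp (-k₂ N)` and Hamiltonians at distance `a = o(N)`. -/
lemma error_le {β k k₁ k₂ a m δ : ℝ} {K D N : ℕ} (hk : 0 < k) (hk₁ : k ≤ k₁)
    (hk₂ : k ≤ k₂) (hm : 0 ≤ m) (ha0 : 0 ≤ β * a) (ha : 10 * (β * a) ≤ k / 4 * N)
    (hT : (1 / 2 : ℝ) ^ (D * N) ≤ Real.exp (-k₁ * N) * m) :
    K * (Real.exp (-k₂ * N) * Real.exp (2 * β * a) ^ 2 * m
        + (2 * (D * N : ℕ) * (2 * Real.exp (β * (δ + 2 * a)) * Real.exp (-k₁ * N)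
            * Real.exp (2 * β * a) ^ 4 * m) + (1 / 2) ^ (D * N)))
      ≤ K * (2 + 16 * D * Real.exp (β * δ) / k) * Real.exp (-(k / 2) * N) * m := by
  have hN : (0 : ℝ) ≤ N := Nat.cast_nonneg N
  have hkN1 := mul_le_mul_of_nonneg_right hk₁ hN
  have hkN2 := mul_le_mul_of_nonneg_right hk₂ hN
  have hkN := mul_nonneg hk.le hN
  set e := Real.exp (-(k / 2) * N) with he
  have h1 : Real.exp (-k₂ * N) * Real.exp (2 * β * a) ^ 2 ≤ e := by
    rw [← Real.exp_nat_mul, ← Real.exp_add]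
    refine Real.exp_le_exp.2 ?_
    push_cast
    linarith
  have h2 : N * (Real.exp (β * (δ + 2 * a)) * Real.exp (-k₁ * N) * Real.exp (2 * β * a) ^ 4)
      ≤ 4 / k * Real.exp (β * δ) * e := by
    have h3 : Real.exp (β * (δ + 2 * a)) * Real.exp (-k₁ * N) * Real.exp (2 * β * a) ^ 4
        ≤ Real.exp (β * δ) * (e * Real.exp (-(k / 4 * N))) := by
      rw [← Real.exp_nat_mul, he, ← Real.exp_add, ← Real.exp_add, ← Real.exp_add, ← Real.exp_add]
      refine Real.exp_le_exp.2 ?_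
      push_cast
      linarith
    have h4 : (N : ℝ) * Real.exp (-(k / 4 * N)) ≤ 4 / k := by
      rw [Real.exp_neg, ← div_eq_mul_inv, div_le_iff₀ (Real.exp_pos _), div_mul_eq_mul_div,
        le_div_iff₀ hk]
      linarith [Real.add_one_le_exp (k / 4 * N)]
    calc _ ≤ (N : ℝ) * (Real.exp (β * δ) * (e * Real.exp (-(k / 4 * N)))) := by gcongr
      _ = (N * Real.exp (-(k / 4 * N))) * (Real.exp (β * δ) * e) := by ring
      _ ≤ 4 / k * (Real.exp (β * δ) * e) := by
          gcongr
      _ = _ := by ring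
  have h5 : (1 / 2 : ℝ) ^ (D * N) ≤ e * m := by
    refine hT.trans (mul_le_mul_of_nonneg_right (Real.exp_le_exp.2 ?_) hm)
    linarith
  push_cast
  calc _ = K * (Real.exp (-k₂ * N) * Real.exp (2 * β * a) ^ 2 * m
          + (4 * D * (N * (Real.exp (β * (δ + 2 * a)) * Real.exp (-k₁ * N)
            * Real.exp (2 * β * a) ^ 4)) * m + (1 / 2) ^ (D * N))) := by ring
    _ ≤ K * (e * m + (4 * D * (4 / k * Real.exp (β * δ) * e) * m + e * m)) := by gcongr
    _ = _ := by ring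

end GlauberMeta

theorem mainTheorem5 {β k₁ k₂ : ℝ} (hβ : 0 < β) (hk₁ : 0 < k₁) (hk₂ : 0 < k₂)
    (a : ℕ → ℝ) (ha : ∀ N, 0 ≤ a N)
    (ha' : Tendsto (fun N : ℕ => a N / (N : ℝ)) atTop (𝓝 0)) :
    ∃ C : ℝ, 0 < C ∧ C < min k₁ k₂ ∧ ∃ N₀ : ℕ, 2 ≤ N₀ ∧
      ∀ (h kJ : ℝ), 0 < kJ → ∀ K : ℕ, 2 ≤ K → ∃ c : ℝ,
      ∀ (Ω : Type*) (G : MeasurableSpace Ω) [mΩ : MeasurableSpace Ω] (_ : G ≤ mΩ)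
        (P : Measure Ω) [IsProbabilityMeasure P]
        (J : ℕ → ℕ → Ω → ℝ)
        (_ : ∀ i j, i < j → Measurable (J i j))
        (_ : ∀ i j, i < j → ∀ᵐ ω ∂P, |J i j ω| ≤ kJ)
        (M S : (N : ℕ) → Ω → Fin K → Finset (Config N))
        (i : Fin K) (_ : 0 < (i : ℕ))
        -- on the metastability event of the annealed model, `M` is a choice of metastable sets
        -- and `S` a metastable partition
        (_ : ∀ N, 2 ≤ N → ∀ᵐ ω ∂P, ω ∈ annealedMetaEvent G P J h N β k₁ K →
          IsMetastable β (annealedH G P J h N ω) (Real.exp (-k₁ * N)) (M N ω) ∧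
          IsMetastablePartition β (annealedH G P J h N ω) (M N ω) (S N ω))
        -- non-degeneracy
        (_ : ∀ N, 2 ≤ N → ∀ᵐ ω ∂P, ω ∈ annealedMetaEvent G P J h N β k₁ K →
          (∀ j l, j ≤ l → gibbsMass β (annealedH G P J h N ω) (M N ω l)
            ≤ gibbsMass β (annealedH G P J h N ω) (M N ω j)) ∧
          (∀ j, i < j → gibbsMass β (annealedH G P J h N ω) (S N ω j)
            ≤ Real.exp (-k₂ * N) * gibbsMass β (annealedH G P J h N ω) (S N ω i))),
        ∀ N, N₀ ≤ N → ∀ᵐ ω ∂P,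
          ω ∈ closeEvent G P J h N (a N) ∩ annealedMetaEvent G P J h N β k₁ K →
          |gibbsNorm β (quenchedH J h N ω) (equilibriumPotential β (quenchedH J h N ω)
                (M N ω i) ((Finset.Iio i).biUnion (M N ω)))
              - gibbsMass β (quenchedH J h N ω) (S N ω i)|
            ≤ c * Real.exp (-C * N) * gibbsMass β (quenchedH J h N ω) (S N ω i) := by
  set k := min k₁ k₂ with hk
  have hk0 : 0 < k := lt_min hk₁ hk₂
  obtain ⟨N₁, hN₁⟩ := eventually_atTop.1
    (ha'.eventually_lt_const (show 0 < k / (40 * β) by positivity))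
  refine ⟨k / 2, by linarith, by linarith, max 2 N₁, le_max_left _ _, ?_⟩
  intro h kJ hkJ K hK
  -- `2 ^ (-D N)`, the lowest dyadic level, is at most `exp (-k₁ N)` times the mass of any
  -- configuration
  obtain ⟨D, hD⟩ := pow_unbounded_of_one_lt
    (Real.exp (k₁ + (2 * β * (kJ + |h|) + Real.log 2))) one_lt_two
  refine ⟨K * (2 + 16 * D * Real.exp (β * (4 * kJ + 2 * |h|)) / k), ?_⟩
  intro Ω G mΩ _ P _ J _ hJ M S i hi hMS hnd N hN
  have hN2 : 2 ≤ N := (le_max_left _ _).trans hN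
  have hNpos : 0 < N := by omega
  have hNr : (0 : ℝ) < N := by exact_mod_cast hNpos
  have hJ' : ∀ᵐ ω ∂P, ∀ i j, i < j → |J i j ω| ≤ kJ := by
    simpa only [ae_all_iff] using hJ
  filter_upwards [hMS N hN2, hnd N hN2, hJ'] with ω h1 h2 h3 hω
  obtain ⟨hM, hS⟩ := h1 hω.2
  have hclose : ∀ σ, |quenchedH J h N ω σ - annealedH G P J h N ω σ| ≤ a N := fun σ =>
    (hω.1 σ).le
  have hflip : ∀ σ τ, IsFlip σ τ →
      annealedH G P J h N ω τ - annealedH G P J h N ω σ ≤ 4 * kJ + 2 * |h| + 2 * a N := by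
    intro σ τ hf
    have hq : quenchedH J h N ω τ - quenchedH J h N ω σ ≤ 4 * kJ + 2 * |h| :=
      hamiltonian_sub_le hNpos hkJ.le h3 hf
    have := abs_le.1 (hclose σ)
    have := abs_le.1 (hclose τ)
    linarith
  refine (abs_gibbsNorm_sub_gibbsMass_le hβ hNpos hK hclose
    (by have := ha N; positivity) hflip (Real.exp_pos _).le (Real.exp_pos _).le hM hS hi
    (h2 hω.2).2 (D * N)).trans ?_
  refine error_le hk0 (min_le_left _ _) (min_le_right _ _)
    (gibbsMass_pos _ _ ((hM.1 i).mono (hS.2.2 i).1)).le (mul_nonneg hβ.le (ha N)) ?_ ?_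
  · have := (hN₁ N ((le_max_right _ _).trans hN)).le
    rw [div_le_div_iff₀ hNr (by positivity)] at this
    linarith
  · obtain ⟨σ, hσ⟩ := (hM.1 i).mono (hS.2.2 i).1
    have hm : Real.exp (-((2 * β * (kJ + |h|) + Real.log 2) * N))
        ≤ gibbsMass β (quenchedH J h N ω) (S N ω i) :=
      (exp_le_gibbs hβ (fun σ => abs_hamiltonian_le hNpos hkJ.le h3 σ) σ).trans
        (Finset.single_le_sum (f := gibbs β (quenchedH J h N ω))
          (fun σ _ => (gibbs_pos _ _ σ).le) hσ)
    calc (1 / 2 : ℝ) ^ (D * N) = (((2 : ℝ) ^ D)⁻¹) ^ N := by rw [pow_mul, one_div, inv_pow]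
      _ ≤ (Real.exp (k₁ + (2 * β * (kJ + |h|) + Real.log 2)))⁻¹ ^ N := by gcongr
      _ = Real.exp (-k₁ * N) * Real.exp (-((2 * β * (kJ + |h|) + Real.log 2) * N)) := by
          rw [← Real.exp_neg, ← Real.exp_nat_mul, ← Real.exp_add]
          congr 1
          ring
      _ ≤ _ := by gcongr
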